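/- An *allowable sequence* of $N$ points is a doubly infinite sequence $\Pi=(\pi_i)_{i\in\mathbb Z}$ of permutations of $N$ points, labelled so that $\pi_0=(1,2,\dots,N)$, such that: (a) for some integer $h\ge 1$, the *length of a halfperiod*, $\pi_{i+h}$ is the reversal of $\pi_i$ for every $i$; (b) for every $i$, $\pi_i$ is obtained from $\pi_{i-1}$ by reversing one or more disjoint substrings of consecutive elements, each with at least two elements (these reversals are called *switches*, and together they form the $i$-th *move*); (c) every pair of points takes part in a common switch in exactly one of the moves $1,\dots,h$. It is *geometrically realizable* if it is the circular sequence of a set of $N$ labelled points in the plane, that is, the sequence of orders of the orthogonal projections of these points onto a directed line that rotates, a new permutation being recorded each time the order changes. Let $\Pi$ be an allowable sequence of $2n$ points. A switch of $\Pi$ is *crossing* if it reverses a centered substring (one occupying positions $a,\dots,2n+1-a$). $\Pi$ is *centrally symmetric* if for every point $p$ there is a point $\overline p$ whose position in every permutation is $2n+1$ minus the position of $p$; it is *in noncentral general position* if every switch that is not crossing reverses exactly two points; it is *even-near-critical* if $h=2n$. Its *central signature* is $(d_1,\dots,d_t)$ if exactly $t$ crossing switches occur in the moves $1,\dots,h$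 and the $k$-th of them reverses $2d_k$ points. For a sequence $d=(d_1,\dots,d_t)$ of positive integers, $\mathrm{DC}^{cs}_{ncgen}(d)$ denotes the even-near-critical centrally symmetric allowable sequence in noncentral general position with central signature $d$ whose first move (from $\pi_0$ to $\pi_1$) includes a crossing switch; up to the labelling of the points it is unique. **Theorem.** Let $t\ge 3$ and let $d=(d_1,\dots,d_t)$ be a sequence of positive integers such that $d_i=d_{i+2}=2$ and $d_{i+1}=1$ for some $i\in\{1,\dots,t\}$, with subindices taken modulo $t$. Then $\mathrm{DC}^{cs}_{ncgen}(d)$ is not geometrically realizable. -/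

import Mathlib

/-- `IsMove σ τ S`: the arrangement `τ` is obtained from the arrangement `σ` by reversing one or
more disjoint substrings of consecutive elements. An arrangement is given by its position map
(`σ p` is the position of the point `p`; positions run from `0` to `N - 1`), and `S` is the set of
reversed substrings (the *switches*), a switch `(a, b)` with `a < b` being the substring in
positions `a, a + 1, …, b`. -/
structure IsMove {N : ℕ} (σ τ : Equiv.Perm (Fin N)) (S : Finset (Fin N × Fin N)) : Prop where
  nonempty : S.Nonempty
  lt : ∀ s ∈ S, s.1 < s.2
  disjoint : ∀ s ∈ S, ∀ s' ∈ S, s ≠ s' →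
    Disjoint (Finset.Icc s.1 s.2) (Finset.Icc s'.1 s'.2)
  reverse : ∀ s ∈ S, ∀ p, σ p ∈ Finset.Icc s.1 s.2 →
    (τ p : ℕ) + (σ p : ℕ) = (s.1 : ℕ) + (s.2 : ℕ)
  fixed : ∀ p, (∀ s ∈ S, σ p ∉ Finset.Icc s.1 s.2) → τ p = σ p

/-- An allowable sequence of `N` points, the points being labelled by their positions in the
permutation of index `0`. `pos i p` is the position of the point `p` in the `i`-th permutation,
`move i` is the set of switches leading from permutation `i - 1` to permutation `i`, and
`halfLength` is the length `h` of a halfperiod. -/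
structure AllowableSequence (N : ℕ) where
  pos : ℤ → Equiv.Perm (Fin N)
  move : ℤ → Finset (Fin N × Fin N)
  halfLength : ℕ
  pos_zero : pos 0 = 1
  halfLength_pos : 0 < halfLength
  pos_add_halfLength : ∀ i p, pos (i + halfLength) p = Fin.rev (pos i p)
  isMove : ∀ i, IsMove (pos (i - 1)) (pos i) (move i)
  switch_once : ∀ p q, p ≠ q → ∃! i : ℤ, i ∈ Set.Icc 1 (halfLength : ℤ) ∧
    ∃ s ∈ move i, pos (i - 1) p ∈ Finset.Icc s.1 s.2 ∧ pos (i - 1) q ∈ Finset.Icc s.1 s.2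

/-- A switch is crossing if it reverses a centered substring. -/
def IsCrossing {N : ℕ} (s : Fin N × Fin N) : Prop :=
  s.2 = Fin.rev s.1

namespace AllowableSequence

variable {N : ℕ}

/-- Every point `p` has a conjugate `p'`, whose position is always symmetric to that of `p`. -/
def IsCentrallySymmetric (A : AllowableSequence N) : Prop :=
  ∀ p, ∃ p', ∀ i, A.pos i p' = Fin.rev (A.pos i p)

/-- Noncentral general position: every switch that is not crossing is a transposition. -/
def InNoncentralGeneralPosition (A : AllowableSequence N) : Prop :=
  ∀ i, ∀ s ∈ A.move i, ¬ IsCrossing s → (s.2 : ℕ) = s.1 + 1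

/-- The number of points is even and equal to the length of a halfperiod. -/
def IsEvenNearCritical (A : AllowableSequence N) : Prop :=
  Even N ∧ A.halfLength = N

/-- `(d 0, …, d (t - 1))` is the central signature: the crossing switches in the halfperiod
starting at permutation `0` occur exactly in the moves `m 0 < ⋯ < m (t - 1)`, and the `k`-th of
them reverses `2 * d k` points. -/
def HasCentralSignature (A : AllowableSequence N) {t : ℕ} (d : Fin t → ℕ) : Prop :=
  ∃ m : Fin t → ℤ, StrictMono m ∧
    (∀ j : ℤ, (j ∈ Set.Icc 1 (A.halfLength : ℤ) ∧ ∃ s ∈ A.move j, IsCrossing s) ↔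
      j ∈ Set.range m) ∧
    ∀ k, ∃ s ∈ A.move (m k), IsCrossing s ∧ (Finset.Icc s.1 s.2).card = 2 * d k

/-- The defining properties of the sequence `DC^cs_ncgen(d)`. -/
structure IsDC {n : ℕ} (A : AllowableSequence (2 * n)) {t : ℕ} (d : Fin t → ℕ) : Prop where
  evenNearCritical : A.IsEvenNearCritical
  centrallySymmetric : A.IsCentrallySymmetric
  noncentralGeneralPosition : A.InNoncentralGeneralPosition
  centralSignature : A.HasCentralSignature d
  crossing_first : ∃ s ∈ A.move 1, IsCrossing s

end AllowableSequence

/-- The coordinate of the orthogonal projection of `x` onto the oriented line through the origin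
with direction `(cos θ, sin θ)`. -/
noncomputable def directionalProj (θ : ℝ) (x : ℝ × ℝ) : ℝ :=
  x.1 * Real.cos θ + x.2 * Real.sin θ

/-- `A` is the circular sequence of the labelled planar point set `P`. As the direction `θ` of the
line of projection rotates, the order of the projections changes exactly at the angles at which two
points of `P` have the same projection; these angles are listed increasingly as
`⋯ < α (-1) < α 0 < α 1 < ⋯`, and for `θ` between `α i` and `α (i + 1)` the order of the
projections is the `i`-th permutation of `A`. -/
def IsCircularSequence {N : ℕ} (P : Fin N → ℝ × ℝ) (A : AllowableSequence N) : Prop :=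
  Function.Injective P ∧ ∃ α : ℤ → ℝ, StrictMono α ∧
    Set.range α = {θ | ∃ p q, p ≠ q ∧ directionalProj θ (P p) = directionalProj θ (P q)} ∧
    ∀ i θ, α i < θ → θ < α (i + 1) → ∀ p q,
      directionalProj θ (P p) < directionalProj θ (P q) ↔ A.pos i p < A.pos i q

/-- An allowable sequence is geometrically realizable if it is the circular sequence of a set of
points in the plane. -/
def AllowableSequence.IsGeometricallyRealizable {N : ℕ} (A : AllowableSequence N) : Prop :=
  ∃ P : Fin N → ℝ × ℝ, IsCircularSequence P A

/-! Positions are recorded as odd integers `u` symmetric about 0, so that conjugate points have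
opposite coordinates and a point crosses exactly when its coordinate changes sign. Around a crossing
switch of `2 * D` points the innermost pair holds the two central places for `2 * D` consecutive
times, because its neighbours belong to the same switch and cannot be inverted with it again. Within
a halfperiod these time intervals are disjoint, and since every point crosses once, their lengths
add up to `2 * n`, the length of a halfperiod. Hence they tile the time axis, and consecutive
crossings are separated by the sum of their radii (`radius_add_le`, `exists_radius`, `exists_next`).
Outside its interval an innermost point has `2 * n - 2 * D` points to meet in `2 * n - 2 * D + 1`
moves; with at most one pause it must run straight outwards and straight back (`Crosses.path_after`,
`Crosses.path_before`).

For consecutive radii 2, 1, 2 these straight paths force inversions among five points `a`, `b`, `x`,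
`y`, `z` and their conjugates (`exists_core`); the next crossing forces further ones
(`exists_outer`, or `inverts_closed` if that crossing is the first one again).

In a realization, pairs inverted by one move span parallel lines, and pairs inverted by different
moves of a halfperiod do not. It follows that conjugate pairs crossing at different moves have a
common midpoint (`add_bar_eq`). With this midpoint as origin and `a`, `y` as basis, the parallelisms
give `b = l • a`, `z = l • y`, `x = k • (a - y)` with `k * (1 - l) = 1`, and those supplied by the
next crossing are inconsistent with this (`core_false_of_outer`, `core_false_of_closed`). -/

/-! ### Sweeps: crossings and inversions -/

/-- A centrally symmetric sweep of `2 * n` points in noncentral general position. The integer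
`u i p` is the signed, doubled distance of the position of `p` from the centre after move `i`,
and `2 * D i` is the number of points reversed by the crossing switch of move `i`
(with `D i = 0` if there is none). -/
structure SymmetricSweep (n : ℕ) where
  u : ℤ → Fin (2 * n) → ℤ
  D : ℤ → ℤ
  odd : ∀ i p, u i p % 2 = 1
  lower : ∀ i p, -(2 * n : ℤ) < u i p
  upper : ∀ i p, u i p < 2 * n
  inj : ∀ i p q, u i p = u i q → p = q
  surj : ∀ i v, v % 2 = 1 → -(2 * n : ℤ) < v → v < 2 * n → ∃ p, u i p = v
  conj : ∀ p, ∃ p', ∀ i, u i p' = -u i p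
  anti : ∀ i p, u (i + 2 * n) p = -u i p
  D_nonneg : ∀ i, 0 ≤ D i
  D_le : ∀ i, D i ≤ n
  cross : ∀ i p, -(2 * D i) < u (i - 1) p → u (i - 1) p < 2 * D i → u i p = -u (i - 1) p
  step : ∀ i p, ¬ (-(2 * D i) < u (i - 1) p ∧ u (i - 1) p < 2 * D i) →
    (0 < u (i - 1) p ↔ 0 < u i p) ∧
    (u i p = u (i - 1) p ∨ ((u i p = u (i - 1) p + 2 ∨ u i p = u (i - 1) p - 2) ∧
      ∃ q, u (i - 1) q = u i p ∧ u i q = u (i - 1) p))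
  once : ∀ (i j : ℤ) (p q : Fin (2 * n)), i < j → j < i + 2 * n →
    ((u (i - 1) p < u (i - 1) q ∧ u i q < u i p) ∨ (u (i - 1) q < u (i - 1) p ∧ u i p < u i q)) →
    ¬ ((u (j - 1) p < u (j - 1) q ∧ u j q < u j p) ∨ (u (j - 1) q < u (j - 1) p ∧ u j p < u j q))

namespace SymmetricSweep

variable {n : ℕ} (S : SymmetricSweep n)

/-- The point `p` belongs to the crossing switch of move `i`. -/
def Crosses (i : ℤ) (p : Fin (2 * n)) : Prop :=
  -(2 * S.D i) < S.u (i - 1) p ∧ S.u (i - 1) p < 2 * S.D i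

/-- Move `i` reverses the order of `p` and `q`. -/
def Inverts (i : ℤ) (p q : Fin (2 * n)) : Prop :=
  (S.u (i - 1) p < S.u (i - 1) q ∧ S.u i q < S.u i p) ∨
    (S.u (i - 1) q < S.u (i - 1) p ∧ S.u i p < S.u i q)

variable {S}

theorem Inverts.symm {i : ℤ} {p q : Fin (2 * n)} (h : S.Inverts i p q) : S.Inverts i q p :=
  Or.symm h

theorem Crosses.eq_neg {i : ℤ} {p : Fin (2 * n)} (h : S.Crosses i p) :
    S.u i p = -S.u (i - 1) p :=
  S.cross i p h.1 h.2

theorem Inverts.unique {i j : ℤ} {p q : Fin (2 * n)} (hi : S.Inverts i p q)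
    (hj : S.Inverts j p q) (h₁ : i - j < 2 * n) (h₂ : j - i < 2 * n) : i = j := by
  rcases lt_trichotomy i j with h | h | h
  · exact absurd hj (S.once i j p q h (by omega) hi)
  · exact h
  · exact absurd hi (S.once j i p q h (by omega) hj)

/-- No point can enter the central block by a transposition: it would have to exchange places with a
point of the block, and that one is reflected instead. This makes `Crosses` symmetric under time
reversal. -/
theorem crosses_iff_after {i : ℤ} {p : Fin (2 * n)} :
    S.Crosses i p ↔ -(2 * S.D i) < S.u i p ∧ S.u i p < 2 * S.D i := by
  constructor
  · intro h
    have := h.eq_neg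
    obtain ⟨h₁, h₂⟩ := h
    omega
  · intro h
    by_contra hc
    rcases (S.step i p hc).2 with h' | ⟨-, q, hq, hq'⟩
    · exact hc (by unfold Crosses; omega)
    · have hcq : S.Crosses i q := by unfold Crosses; omega
      have := hcq.eq_neg
      exact hc (by unfold Crosses; omega)

theorem Crosses.radius_pos {i : ℤ} {p : Fin (2 * n)} (h : S.Crosses i p) : 0 < S.D i := by
  obtain ⟨h₁, h₂⟩ := h
  omega

theorem crosses_iff_sign {i : ℤ} {p : Fin (2 * n)} :
    S.Crosses i p ↔ ¬ (0 < S.u (i - 1) p ↔ 0 < S.u i p) := by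
  constructor
  · intro h
    have := h.eq_neg
    have := S.odd i p
    omega
  · intro h
    by_contra hc
    exact h (S.step i p hc).1

/-- Conjugates lie on opposite sides of the centre, so a change of sign is an inversion of the
conjugate pair. Through this, `once` says that no point crosses twice in a halfperiod. -/
theorem crosses_iff_inverts {i : ℤ} {p p' : Fin (2 * n)} (hp : ∀ i, S.u i p' = -S.u i p) :
    S.Crosses i p ↔ S.Inverts i p p' := by
  rw [crosses_iff_sign, Inverts, hp, hp]
  have := S.odd i p
  have := S.odd (i - 1) p
  omega

theorem Crosses.unique {i j : ℤ} {p : Fin (2 * n)} (hi : S.Crosses i p)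
    (hj : S.Crosses j p) (h₁ : i - j < 2 * n) (h₂ : j - i < 2 * n) : i = j := by
  obtain ⟨p', hp⟩ := S.conj p
  exact ((crosses_iff_inverts hp).1 hi).unique ((crosses_iff_inverts hp).1 hj) h₁ h₂

theorem anti_sub_one (i : ℤ) (p : Fin (2 * n)) :
    S.u (i + 2 * n - 1) p = -S.u (i - 1) p := by
  rw [← S.anti, show i + 2 * n - 1 = i - 1 + 2 * (n : ℤ) by ring]

theorem crosses_add_iff {i : ℤ} {p : Fin (2 * n)} :
    S.Crosses (i + 2 * n) p ↔ S.Crosses i p := by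
  rw [crosses_iff_sign, crosses_iff_sign, S.anti, anti_sub_one]
  have := S.odd i p
  have := S.odd (i - 1) p
  omega

-- The radius is recovered from the set of crossing points, so that the periodicity of `u` passes to
-- `D`, for which it is not assumed.
open Classical in
theorem card_crosses (i : ℤ) :
    ((Finset.univ.filter fun p => S.Crosses i p).card : ℤ) = 2 * S.D i := by
  have h₀ := S.D_nonneg i
  have h₁ := S.D_le i
  rw [show 2 * S.D i = ((Finset.Ico (-S.D i) (S.D i)).card : ℤ) by simp; omega, Nat.cast_inj]
  -- The odd coordinates `2 * v + 1` inside the block correspond to `-D ≤ v < D`.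
  apply Finset.card_bij (fun p _ => (S.u (i - 1) p - 1) / 2)
  · intro p hp
    have := S.odd (i - 1) p
    have hp : S.Crosses i p := (Finset.mem_filter.1 hp).2
    unfold Crosses at hp
    rw [Finset.mem_Ico]
    omega
  · intro p _ q _ h
    have := S.odd (i - 1) p
    have := S.odd (i - 1) q
    exact S.inj (i - 1) p q (by omega)
  · intro v hv
    simp only [Finset.mem_Ico] at hv
    obtain ⟨p, hp⟩ := S.surj (i - 1) (2 * v + 1) (by omega) (by omega) (by omega)
    exact ⟨p, Finset.mem_filter.2 ⟨Finset.mem_univ _, by unfold Crosses; omega⟩, by omega⟩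

theorem radius_add (i : ℤ) : S.D (i + 2 * n) = S.D i := by
  classical
  have h₁ := S.card_crosses i
  have h₂ := S.card_crosses (i + 2 * n)
  simp only [crosses_add_iff] at h₂
  omega

theorem exists_crosses (p : Fin (2 * n)) (a : ℤ) :
    ∃ i, a < i ∧ i ≤ a + 2 * n ∧ S.Crosses i p := by
  by_contra! h
  have key : ∀ k : ℕ, k ≤ 2 * n → (0 < S.u (a + k) p ↔ 0 < S.u a p) := by
    intro k
    induction k with
    | zero => simp
    | succ k ih =>
      intro hk
      have := h (a + (k + 1 : ℕ)) (by push_cast; omega) (by push_cast; omega)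
      rw [crosses_iff_sign, not_not,
        show a + ((k + 1 : ℕ) : ℤ) - 1 = a + k by push_cast; ring] at this
      rw [← this, ih (by omega)]
  have h₁ := key (2 * n) le_rfl
  push_cast at h₁
  rw [S.anti] at h₁
  have := S.odd a p
  omega

theorem Inverts.exists_between {a : ℤ} {p q : Fin (2 * n)} (k : ℕ)
    (h : ¬ (S.u a p < S.u a q ↔ S.u (a + k) p < S.u (a + k) q)) :
    ∃ i, a < i ∧ i ≤ a + k ∧ S.Inverts i p q := by
  by_contra! hi
  have hpq : p ≠ q := by
    rintro rfl
    simp at h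
  have key : ∀ m : ℕ, m ≤ k → (S.u a p < S.u a q ↔ S.u (a + m) p < S.u (a + m) q) := by
    intro m
    induction m with
    | zero => simp
    | succ m ih =>
      intro hm
      have h₁ := hi (a + (m + 1 : ℕ)) (by push_cast; omega) (by push_cast; omega)
      rw [Inverts, show a + ((m + 1 : ℕ) : ℤ) - 1 = a + m by push_cast; ring] at h₁
      rw [ih (by omega)]
      have h₂ : S.u (a + m) p ≠ S.u (a + m) q := fun h => hpq (S.inj _ _ _ h)
      have h₃ : S.u (a + (m + 1 : ℕ)) p ≠ S.u (a + (m + 1 : ℕ)) q :=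
        fun h => hpq (S.inj _ _ _ h)
      omega
  exact h (key k le_rfl)

theorem exists_inverts {p q : Fin (2 * n)} (hpq : p ≠ q) (a : ℤ) :
    ∃ i, a < i ∧ i ≤ a + 2 * n ∧ S.Inverts i p q := by
  have := Inverts.exists_between (S := S) (a := a) (p := p) (q := q) (2 * n) (by
    push_cast
    rw [S.anti, S.anti]
    have : S.u a p ≠ S.u a q := fun h => hpq (S.inj _ _ _ h)
    omega)
  simpa using this

theorem Crosses.inverts {i : ℤ} {p q : Fin (2 * n)} (hp : S.Crosses i p) (hq : S.Crosses i q)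
    (hpq : p ≠ q) : S.Inverts i p q := by
  have h₁ := hp.eq_neg
  have h₂ := hq.eq_neg
  have h₃ : S.u i p ≠ S.u i q := fun h => hpq (S.inj _ _ _ h)
  unfold Inverts
  omega

/-- A point moved by a noncrossing switch exchanges its position with the point that it inverts. -/
theorem exchange {i : ℤ} {p q : Fin (2 * n)} (hc : ¬ S.Crosses i p)
    (hm : S.u i p ≠ S.u (i - 1) p) (hq : S.u (i - 1) q = S.u i p) :
    S.u i q = S.u (i - 1) p ∧ S.Inverts i p q := by
  obtain ⟨h, q', hq', hq''⟩ := (S.step i p hc).2.resolve_left hm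
  obtain rfl : q = q' := S.inj (i - 1) _ _ (by omega)
  exact ⟨hq'', by unfold Inverts; omega⟩

theorem step_le {i : ℤ} {p : Fin (2 * n)} (hc : ¬ S.Crosses i p) :
    S.u i p = S.u (i - 1) p ∨ S.u i p = S.u (i - 1) p + 2 ∨ S.u i p = S.u (i - 1) p - 2 := by
  rcases (S.step i p hc).2 with h | ⟨h, -⟩
  · exact Or.inl h
  · exact Or.inr h

/-- If a noncrossing point takes part in an inversion, it moves, and its partner is determined. -/
theorem Inverts.partner {i : ℤ} {p q : Fin (2 * n)} (h : S.Inverts i p q)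
    (hc : ¬ S.Crosses i p) : S.u i p ≠ S.u (i - 1) p ∧ S.u (i - 1) q = S.u i p := by
  have hcq : ¬ S.Crosses i q := by
    intro hq
    have h₁ := hq.eq_neg
    have h₂ := crosses_iff_sign.not.1 hc
    have h₃ := crosses_iff_after.not.1 hc
    have h₄ := hc
    unfold Crosses at h₄ hq
    unfold Inverts at h
    have h₅ := crosses_iff_sign.1 hq
    omega
  have op := S.odd i p
  have oq := S.odd i q
  have op' := S.odd (i - 1) p
  have oq' := S.odd (i - 1) q
  have s₁ := step_le hc
  have s₂ := step_le hcq
  have hne : S.u (i - 1) p ≠ S.u i p := by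
    intro he
    rcases (S.step i q hcq).2 with h' | ⟨h', r, hr, hr'⟩
    · unfold Inverts at h
      omega
    · have : S.u i q = S.u (i - 1) p := by
        unfold Inverts at h
        omega
      have : r = p := S.inj (i - 1) _ _ (by omega)
      subst this
      omega
  refine ⟨hne.symm, ?_⟩
  obtain ⟨h', r, hr, hr'⟩ := (S.step i p hc).2.resolve_left hne.symm
  by_contra hqr
  have : S.u i q ≠ S.u (i - 1) p := by
    intro hh
    exact hqr (by rw [S.inj i q r (by omega)]; exact hr)
  unfold Inverts at h
  omega

/-! ### Central intervals and the timing of crossings -/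

/-- The points of a crossing switch stay where they are until the outer ones have moved away. -/
theorem Crosses.hold {i : ℤ} (s : ℕ) : ∀ {p : Fin (2 * n)}, S.Crosses i p →
    -(2 * S.D i) < S.u i p - 2 * s → S.u i p + 2 * s < 2 * S.D i →
    -(2 * S.D i) < S.u i p + 2 * s → S.u i p - 2 * s < 2 * S.D i →
    S.u (i + s) p = S.u i p := by
  induction s with
  | zero => simp
  | succ s ih =>
    intro p hp h₁ h₂ h₃ h₄
    push_cast at h₁ h₂ h₃ h₄ ⊢
    have hD := S.D_le i
    have e := ih hp (by omega) (by omega) (by omega) (by omega)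
    have hc : ¬ S.Crosses (i + (s + 1)) p := by
      intro hc
      have := hp.unique hc (by omega) (by omega)
      omega
    have hi : i + ((s : ℤ) + 1) - 1 = i + s := by ring
    rcases (S.step _ p hc).2 with h | ⟨h, q, hq, hq'⟩
    · rw [h, hi, e]
    · exfalso
      rw [hi] at h hq hq'
      -- The place entered by `p` is still held by a point `r` of the same crossing switch, so `p`
      -- and `r` would be inverted a second time.
      obtain ⟨r, hr⟩ := S.surj i (S.u (i + (s + 1)) p) (S.odd _ _) (S.lower _ _) (S.upper _ _)
      have hcr : S.Crosses i r := crosses_iff_after.2 (by omega)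
      have er := ih hcr (by omega) (by omega) (by omega) (by omega)
      obtain rfl : r = q := S.inj (i + s) _ _ (by omega)
      have hpr : p ≠ r := by
        rintro rfl
        omega
      have hinv : S.Inverts (i + (s + 1)) p r := by
        unfold Inverts
        rw [hi]
        omega
      have := (hp.inverts hcr hpr).unique hinv (by omega) (by omega)
      omega

variable (S) in
/-- The time reversal of a sweep. -/
def reverse : SymmetricSweep n where
  -- With this shift, move `i` of the reversal leads from `S.u (-i)` to `S.u (-i - 1)`: it is move
  -- `-i` of `S` undone.
  u i := S.u (-1 - i)
  D i := S.D (-i)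
  odd i p := S.odd _ p
  lower i p := S.lower _ p
  upper i p := S.upper _ p
  inj i p q := S.inj _ p q
  surj i v := S.surj _ v
  conj p := by
    obtain ⟨p', hp⟩ := S.conj p
    exact ⟨p', fun i => hp _⟩
  anti i p := by
    have := S.anti (-1 - (i + 2 * n)) p
    rw [show -1 - (i + 2 * (n : ℤ)) + 2 * n = -1 - i by ring] at this
    omega
  D_nonneg i := S.D_nonneg _
  D_le i := S.D_le _
  cross i p h₁ h₂ := by
    rw [show -1 - (i - 1) = -i by ring] at h₁ h₂ ⊢
    rw [show -1 - i = -i - 1 by ring]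
    have := (crosses_iff_after.2 ⟨h₁, h₂⟩).eq_neg
    omega
  step i p h := by
    rw [show -1 - (i - 1) = -i by ring] at h ⊢
    rw [show -1 - i = -i - 1 by ring]
    have hc : ¬ S.Crosses (-i) p := crosses_iff_after.not.2 h
    obtain ⟨h₁, h₂⟩ := S.step (-i) p hc
    refine ⟨h₁.symm, ?_⟩
    rcases h₂ with h₂ | ⟨h₂, q, hq, hq'⟩
    · exact Or.inl h₂.symm
    · exact Or.inr ⟨by omega, q, hq', hq⟩
  once i j p q hij hji h h' := by
    rw [show -1 - (i - 1) = -i by ring, show -1 - i = -i - 1 by ring] at h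
    rw [show -1 - (j - 1) = -j by ring, show -1 - j = -j - 1 by ring] at h'
    have h₁ : S.Inverts (-i) p q := by unfold Inverts; omega
    have h₂ : S.Inverts (-j) p q := by unfold Inverts; omega
    have := h₁.unique h₂ (by omega) (by omega)
    omega

theorem reverse_crosses_iff {i : ℤ} {p : Fin (2 * n)} :
    S.reverse.Crosses (-i) p ↔ S.Crosses i p := by
  rw [crosses_iff_after (S := S)]
  simp only [Crosses, reverse, neg_neg]
  rw [show -1 - (-i - 1) = i by ring]

theorem exists_crosses_one {i : ℤ} (h : 0 < S.D i) :
    ∃ p, S.Crosses i p ∧ S.u i p = 1 := by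
  have := S.D_le i
  obtain ⟨p, hp⟩ := S.surj i 1 (by omega) (by omega) (by omega)
  exact ⟨p, crosses_iff_after.2 (by omega), hp⟩

theorem Crosses.hold_one {i : ℤ} {p : Fin (2 * n)} (hp : S.Crosses i p) (h : S.u i p = 1)
    {j : ℤ} (h₁ : i ≤ j) (h₂ : j < i + S.D i) : S.u j p = 1 := by
  have := hp.hold (j - i).toNat (by omega) (by omega) (by omega) (by omega)
  rwa [Int.toNat_of_nonneg (by omega), add_sub_cancel, h] at this

theorem Crosses.hold_one_before {i : ℤ} {p : Fin (2 * n)} (hp : S.Crosses i p)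
    (h : S.u i p = 1) {j : ℤ} (h₁ : i - S.D i ≤ j) (h₂ : j < i) : S.u j p = -1 := by
  obtain ⟨p', hp'⟩ := S.conj p
  have e := hp.eq_neg
  have hr : S.reverse.Crosses (-i) p' := by
    rw [reverse_crosses_iff]
    unfold Crosses at hp ⊢
    rw [hp']
    omega
  have hu : S.reverse.u (-i) p' = 1 := by
    simp only [reverse, hp']
    rw [show -1 - -i = i - 1 by ring]
    omega
  have := hr.hold_one hu (j := -1 - j) (by omega) (by simp only [reverse, neg_neg]; omega)
  simp only [reverse, hp', sub_sub_cancel] at this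
  omega

/-- The central place is taken around each crossing `i` by the innermost pair of that crossing,
for as many moves as the crossing has points. -/
theorem radius_add_le {i j : ℤ} (hi : 0 < S.D i) (hj : 0 < S.D j) (hij : i < j)
    (hji : j < i + 2 * n) : i + S.D i ≤ j - S.D j := by
  by_contra! hlt
  obtain ⟨p, hp, hp1⟩ := exists_crosses_one hi
  obtain ⟨q, hq, hq1⟩ := exists_crosses_one hj
  -- At a time `k` common to both intervals, both innermost pairs occupy the places `1` and `-1`.
  -- They therefore coincide, and their points would cross twice.
  obtain ⟨k, hk₁, hk₂, hk₃, hk₄⟩ : ∃ k, i - S.D i ≤ k ∧ k < i + S.D i ∧ j - S.D j ≤ k ∧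
      k < j + S.D j := by
    rcases le_total (i - S.D i) (j - S.D j) with h | h
    · exact ⟨j - S.D j, by omega, by omega, by omega, by omega⟩
    · exact ⟨i - S.D i, by omega, by omega, by omega, by omega⟩
  have hup : S.u k p = 1 ∨ S.u k p = -1 := by
    rcases lt_or_ge k i with h | h
    · exact Or.inr (hp.hold_one_before hp1 hk₁ h)
    · exact Or.inl (hp.hold_one hp1 h hk₂)
  have huq : S.u k q = 1 ∨ S.u k q = -1 := by
    rcases lt_or_ge k j with h | h
    · exact Or.inr (hq.hold_one_before hq1 hk₃ h)
    · exact Or.inl (hq.hold_one hq1 h hk₄)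
  obtain ⟨p', hp'⟩ := S.conj p
  have hcq : S.Crosses i q := by
    by_cases h : S.u k p = S.u k q
    · rwa [← S.inj k p q h]
    · rw [S.inj k q p' (by rw [hp']; omega)]
      unfold Crosses at hp ⊢
      rw [hp']
      omega
  have := hcq.unique hq (by omega) (by omega)
  omega

theorem radius_add_mul (i k : ℤ) : S.D (i + 2 * n * k) = S.D i := by
  induction k using Int.induction_on with
  | zero => simp
  | succ k ih => rw [← ih, ← radius_add (i + 2 * n * k)]; congr 1; ring
  | pred k ih => rw [← ih, ← radius_add (i + 2 * n * (-k - 1))]; congr 1; ring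

/-- The intervals of times around the crossings cover all times. -/
theorem exists_radius (hn : 0 < n) (s : ℤ) : ∃ i, 0 < S.D i ∧ i - S.D i ≤ s ∧ s < i + S.D i := by
  have : NeZero (2 * n) := ⟨by omega⟩
  choose T hT₁ hT₂ hT₃ using fun p => S.exists_crosses p 0
  -- The `2 * D` points of a crossing at time `T` are sent bijectively to the times in `[T - D, T +
  -- D)`. Disjointness of these intervals makes the map injective modulo `2 * n`, and counting then
  -- makes it surjective.
  have hinj : Function.Injective
      fun p => ((T p + (S.u (T p) p - 1) / 2 : ℤ) : ZMod (2 * n)) := by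
    intro p q hpq
    simp only at hpq
    rw [ZMod.intCast_eq_intCast_iff_dvd_sub] at hpq
    obtain ⟨k, hk⟩ := hpq
    push_cast at hk
    have hp := crosses_iff_after.1 (hT₃ p)
    have hq := crosses_iff_after.1 (hT₃ q)
    have hDp := S.D_le (T p)
    have hDq := S.D_le (T q)
    have hper := S.radius_add_mul (T q) (-k)
    have op := S.odd (T p) p
    have oq := S.odd (T q) q
    set m := 2 * (n : ℤ) * k with hm
    have hm' : 2 * (n : ℤ) * -k = -m := by rw [hm]; ring
    rw [hm'] at hper
    have heq : T p = T q + -m := by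
      rcases lt_trichotomy (T p) (T q + -m) with h | h | h
      · have := radius_add_le (S := S) (i := T p) (j := T q + -m) (by omega) (by omega) h
          (by omega)
        omega
      · exact h
      · have := radius_add_le (S := S) (j := T p) (i := T q + -m) (by omega) (by omega) h
          (by omega)
        omega
    have hk0 : k = 0 := by
      have h₁ := hT₁ p
      have h₂ := hT₁ q
      have h₃ := hT₂ p
      have h₄ := hT₂ q
      have : k < 1 := by
        by_contra hk1
        have : 2 * (n : ℤ) * 1 ≤ 2 * n * k := by gcongr; omega
        omega
      have : -1 < k := by
        by_contra hk1
        have : 2 * (n : ℤ) * k ≤ 2 * n * (-1) := by gcongr; omega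
        omega
      omega
    have hTT : T p = T q := by
      rw [hk0] at hm
      omega
    rw [hTT] at op
    refine S.inj (T q) p q ?_
    rw [hTT] at hk heq
    omega
  have hsurj := ((Fintype.bijective_iff_injective_and_card _).2
    ⟨hinj, by rw [ZMod.card, Fintype.card_fin]⟩).2
  obtain ⟨p, hp⟩ := hsurj (s : ZMod (2 * n))
  simp only at hp
  rw [ZMod.intCast_eq_intCast_iff_dvd_sub] at hp
  obtain ⟨k, hk⟩ := hp
  push_cast at hk
  have hc := crosses_iff_after.1 (hT₃ p)
  have := S.odd (T p) p
  refine ⟨T p + 2 * n * k, ?_⟩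
  rw [radius_add_mul]
  omega

/-- The crossing after a crossing `i`. -/
theorem exists_next {i : ℤ} (hi : 0 < S.D i) :
    ∃ j, 0 < S.D j ∧ j = i + S.D i + S.D j ∧ ∀ k, i < k → k < j → S.D k = 0 := by
  have hDi := S.D_le i
  obtain ⟨j, hj, h₁, h₂⟩ := S.exists_radius (by omega) (i + S.D i)
  have hDj := S.D_le j
  have hij : i < j := by
    by_contra! h
    rcases h.eq_or_lt with rfl | h
    · omega
    · by_cases h' : i < j + 2 * n
      · have := radius_add_le hj hi h h'
        omega
      · omega
  have he : j = i + S.D i + S.D j := by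
    by_cases h' : j < i + 2 * n
    · have := radius_add_le hi hj hij h'
      omega
    · omega
  refine ⟨j, hj, he, fun k hik hkj => ?_⟩
  by_contra hk
  have hk := (S.D_nonneg k).lt_of_ne' hk
  have := radius_add_le hi hk hik (by omega)
  have := radius_add_le hk hj hkj (by omega)
  omega

/-! ### Straight paths of the innermost points -/

/-- A point does not retrace a step in the next move. -/
theorem no_retrace {i : ℤ} {p : Fin (2 * n)} (hi : ¬ S.Crosses i p)
    (hi' : ¬ S.Crosses (i + 1) p) (hm : S.u i p ≠ S.u (i - 1) p) :
    S.u (i + 1) p ≠ S.u (i - 1) p := by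
  intro h
  obtain ⟨-, q, hq, hq'⟩ := (S.step i p hi).2.resolve_left hm
  have h₁ := (exchange hi hm hq).2
  have h₂ := (exchange (q := q) hi' (by rw [add_sub_cancel_right, h]; exact hm.symm)
    (by rw [add_sub_cancel_right, hq', h])).2
  have hn : 0 < n := by
    have := p.2
    omega
  have := h₁.unique h₂ (by omega) (by omega)
  omega

open Classical in
/-- Between two of its crossings a point moves at least once for every point outside of its
crossing switch. -/
theorem Crosses.card_moves {i : ℤ} {p : Fin (2 * n)} (hp : S.Crosses i p) :
    2 * (n : ℤ) - 2 * S.D i ≤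
      ((Finset.Ioo i (i + 2 * n)).filter fun j => S.u j p ≠ S.u (j - 1) p).card := by
  have hpp := hp.eq_neg
  have hc := S.card_crosses i
  have hcard := Finset.card_filter_add_card_filter_not (s := Finset.univ)
    (fun q => S.Crosses i q)
  rw [Finset.card_univ, Fintype.card_fin] at hcard
  have key : (Finset.univ.filter fun q => ¬ S.Crosses i q).card ≤
      ((Finset.Ioo i (i + 2 * n)).filter fun j => S.u j p ≠ S.u (j - 1) p).card := by
    have hex : ∀ q, ¬ S.Crosses i q → ∃ j, i < j ∧ j < i + 2 * n ∧ ¬ S.Crosses j p ∧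
        S.Inverts j p q := by
      intro q hq
      have hpq : p ≠ q := by
        rintro rfl
        exact hq hp
      obtain ⟨j, h₁, h₂, h₃⟩ := S.exists_inverts hpq i
      -- In move `i + 2 * n` the point `p` crosses again, and there it is inverted only with points
      -- of its own block.
      have h₂ : j < i + 2 * n := by
        refine h₂.lt_of_ne ?_
        rintro rfl
        have hp' : S.Crosses (i + 2 * n) p := crosses_add_iff.2 hp
        have hq' : ¬ S.Crosses (i + 2 * n) q := crosses_add_iff.not.2 hq
        have e := crosses_iff_sign.not.1 hq'
        have e' := hq'
        rw [crosses_iff_after] at e'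
        have e₂ := crosses_iff_after.1 hp'
        unfold Crosses at hp' hq'
        unfold Inverts at h₃
        omega
      refine ⟨j, h₁, h₂, fun hj => ?_, h₃⟩
      have := hp.unique hj (by omega) (by omega)
      omega
    choose! f hf₁ hf₂ hf₃ hf₄ using hex
    -- A noncrossing move of `p` has only one partner, namely the point at the place where `p` goes,
    -- so distinct `q` need distinct moves.
    refine Finset.card_le_card_of_injOn f ?_ ?_
    · intro q hq
      have hq : ¬ S.Crosses i q := (Finset.mem_filter.1 hq).2
      exact Finset.mem_filter.2 ⟨Finset.mem_Ioo.2 ⟨hf₁ q hq, hf₂ q hq⟩,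
        ((hf₄ q hq).partner (hf₃ q hq)).1⟩
    · intro q hq r hr hqr
      have hq : ¬ S.Crosses i q := (Finset.mem_filter.1 hq).2
      have hr : ¬ S.Crosses i r := (Finset.mem_filter.1 hr).2
      have h₁ := ((hf₄ q hq).partner (hf₃ q hq)).2
      have h₂ := ((hf₄ r hr).partner (hf₃ r hr)).2
      rw [← hqr] at h₂
      exact S.inj _ _ _ (h₁.trans h₂.symm)
  omega

/-- A positive odd walk with steps `0, ±2` without retraced steps which returns after `2 * m + 1`
steps to its start at `1` and pauses at most once goes straight outwards for `m` steps. -/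
theorem _root_.walk_eq {m : ℕ} {g : ℕ → ℤ} (h0 : g 0 = 1) (hL : g (2 * m + 1) = 1)
    (hpos : ∀ j ≤ 2 * m + 1, 1 ≤ g j)
    (hstep : ∀ j < 2 * m + 1, g (j + 1) = g j ∨ g (j + 1) = g j + 2 ∨ g (j + 1) = g j - 2)
    (hretrace : ∀ j < 2 * m, g (j + 1) ≠ g j → g (j + 2) ≠ g j)
    (hpause : ∀ i < 2 * m + 1, ∀ j < 2 * m + 1, g (i + 1) = g i → g (j + 1) = g j → i = j)
    {j : ℕ} (hj : j ≤ m) : g j = 1 + 2 * j := by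
  -- Without pauses the first step must go up by positivity, and a later step down would retrace the
  -- one before.
  have out : ∀ (f : ℕ → ℤ) (k : ℕ), f 0 = 1 → (∀ j ≤ k, 1 ≤ f j) →
      (∀ j < k, f (j + 1) = f j + 2 ∨ f (j + 1) = f j - 2) →
      (∀ j, j + 1 < k → f (j + 2) ≠ f j) → ∀ j ≤ k, f j = 1 + 2 * j := by
    intro f k f0 fpos fstep fretrace j
    induction j using Nat.strong_induction_on with
    | _ j ih =>
      intro hj
      match j with
      | 0 => simp [f0]
      | 1 =>
        have := fstep 0 (by omega)
        have := fpos 1 hj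
        simp only [zero_add] at *
        omega
      | j + 2 =>
        have h₁ := ih j (by omega) (by omega)
        have h₂ := ih (j + 1) (by omega) (by omega)
        have h₃ := fstep (j + 1) (by omega)
        have h₄ := fretrace j (by omega)
        rw [show j + 1 + 1 = j + 2 by ring] at h₃
        push_cast at *
        omega
  by_cases hex : ∃ k < 2 * m + 1, g (k + 1) = g k
  · obtain ⟨k, hk, hgk⟩ := hex
    have h₁ := out g k h0 (fun j hj => hpos j (by omega))
      (fun j hj => (hstep j (by omega)).resolve_left fun h => by
        have := hpause _ (by omega) _ hk h hgk
        omega)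
      (fun j hj => hretrace j (by omega) fun h => by
        have := hpause _ (by omega) _ hk h hgk
        omega)
    have h₂ := out (fun j => g (2 * m + 1 - j)) (2 * m - k) hL
      (fun j hj => hpos _ (by omega))
      (fun j hj => by
        have e : 2 * m + 1 - j = 2 * m + 1 - (j + 1) + 1 := by omega
        have h := (hstep (2 * m + 1 - (j + 1)) (by omega)).resolve_left fun h => by
          have := hpause _ (by omega) _ hk h hgk
          omega
        simp only [e]
        omega)
      (fun j hj => by
        have e : 2 * m + 1 - j = 2 * m + 1 - (j + 2) + 2 := by omega
        have h := hretrace (2 * m + 1 - (j + 2)) (by omega) fun h => by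
          have := hpause _ (by omega) _ hk h hgk
          omega
        simp only [e]
        exact h.symm)
    have e₁ := h₁ k le_rfl
    have e₂ := h₂ (2 * m - k) le_rfl
    simp only [show 2 * m + 1 - (2 * m - k) = k + 1 by omega] at e₂
    exact h₁ j (by omega)
  · push Not at hex
    have := out g (2 * m + 1) h0 hpos (fun j hj => (hstep j hj).resolve_left (hex j hj))
      (fun j hj => hretrace j (by omega) (hex j (by omega))) (2 * m + 1) le_rfl
    omega

theorem Crosses.not_crosses {i : ℤ} {p : Fin (2 * n)} (hp : S.Crosses i p) {j : ℤ}
    (h₁ : i < j) (h₂ : j < i + 2 * n) : ¬ S.Crosses j p := fun h => by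
  have := hp.unique h (by omega) (by omega)
  omega

/-- After leaving the centre, the innermost point of a crossing moves straight outwards. -/
theorem Crosses.path_after {i : ℤ} {p : Fin (2 * n)} (hp : S.Crosses i p) (h : S.u i p = 1)
    {j : ℤ} (h₁ : i + S.D i - 1 ≤ j) (h₂ : j ≤ i + n - 1) :
    S.u j p = 1 + 2 * (j - (i + S.D i - 1)) := by
  classical
  have hD := hp.radius_pos
  have hDn := S.D_le i
  obtain ⟨d, hd⟩ : ∃ d : ℕ, (d : ℤ) = S.D i := ⟨(S.D i).toNat, by omega⟩
  obtain ⟨m, rfl⟩ : ∃ m, n = d + m := ⟨n - d, by omega⟩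
  have hpos : ∀ k : ℤ, i ≤ k → k < i + 2 * (d + m : ℕ) → 1 ≤ S.u k p := by
    intro k hk hk'
    obtain ⟨k, rfl⟩ : ∃ l : ℕ, k = i + l := ⟨(k - i).toNat, by omega⟩
    induction k with
    | zero => simp [h]
    | succ k ih =>
      have := ih (by omega) (by push_cast at *; omega)
      have hs := crosses_iff_sign.not.1
        (hp.not_crosses (j := i + (k + 1 : ℕ)) (by omega) (by omega))
      rw [show i + ((k + 1 : ℕ) : ℤ) - 1 = i + k by push_cast; ring] at hs
      omega
  have hend : ∀ k : ℤ, i - S.D i ≤ k → k < i → S.u (k + 2 * (d + m : ℕ)) p = 1 := by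
    intro k hk hk'
    rw [S.anti, hp.hold_one_before h hk hk']
    rfl
  -- All moves outside this window leave `p` at rest on a central place. The window has `2 * n - 2 *
  -- D + 1` moves, of which at least `2 * n - 2 * D` must move `p`.
  have hpause : ∀ a b : ℤ, i + S.D i ≤ a → a ≤ i + 2 * (d + m : ℕ) - S.D i →
      i + S.D i ≤ b → b ≤ i + 2 * (d + m : ℕ) - S.D i →
      S.u a p = S.u (a - 1) p → S.u b p = S.u (b - 1) p → a = b := by
    intro a b ha ha' hb hb' hua hub
    by_contra hab
    have hcard := hp.card_moves
    have hsub : ((Finset.Ioo i (i + 2 * (d + m : ℕ))).filter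
        fun j => S.u j p ≠ S.u (j - 1) p) ⊆
        ((Finset.Icc (i + S.D i) (i + 2 * (d + m : ℕ) - S.D i)).erase a).erase b := by
      intro k hk
      obtain ⟨hk, hk'⟩ := Finset.mem_filter.1 hk
      rw [Finset.mem_Ioo] at hk
      rw [Finset.mem_erase, Finset.mem_erase, Finset.mem_Icc]
      refine ⟨?_, ?_, ?_, ?_⟩
      · rintro rfl
        exact hk' hub
      · rintro rfl
        exact hk' hua
      · by_contra! hlt
        rw [hp.hold_one h hk.1.le hlt, hp.hold_one h (by omega) (by omega)] at hk'
        exact hk' rfl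
      · by_contra! hlt
        have e₁ := hend (k - 2 * (d + m : ℕ)) (by omega) (by omega)
        have e₂ := hend (k - 1 - 2 * (d + m : ℕ)) (by omega) (by omega)
        rw [sub_add_cancel] at e₁ e₂
        omega
    have := Finset.card_le_card hsub
    rw [Finset.card_erase_of_mem (Finset.mem_erase.2 ⟨Ne.symm hab, Finset.mem_Icc.2 ⟨hb, hb'⟩⟩),
      Finset.card_erase_of_mem (Finset.mem_Icc.2 ⟨ha, ha'⟩), Int.card_Icc] at this
    omega
  obtain ⟨l, hl⟩ : ∃ l : ℕ, (l : ℤ) = j - (i + S.D i - 1) :=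
    ⟨(j - (i + S.D i - 1)).toNat, by omega⟩
  have hnc : ∀ k : ℕ, k < 2 * m + 1 → ¬ S.Crosses (i + S.D i - 1 + (k + 1)) p := fun k hk =>
    hp.not_crosses (by omega) (by push_cast; omega)
  -- The walk starts at time `i + D - 1`, the last one of the central interval, and ends at `i + 2 *
  -- n - D`, where `p` is back at `1` for its next crossing.
  have := walk_eq (m := m) (g := fun k => S.u (i + S.D i - 1 + k) p) (j := l)
    (by simpa using hp.hold_one h (by omega) (by omega))
    (by
      have := hend (i - S.D i) (by omega) (by omega)
      refine Eq.trans ?_ this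
      congr 1
      push_cast
      omega)
    (fun k hk => hpos _ (by omega) (by push_cast; omega))
    (fun k hk => by
      have := step_le (hnc k hk)
      rw [show i + S.D i - 1 + ((k : ℤ) + 1) - 1 = i + S.D i - 1 + k by ring] at this
      exact_mod_cast this)
    (fun k hk hne => by
      have := no_retrace (hnc k (by omega)) (by
          have := hnc (k + 1) (by omega)
          rwa [show i + S.D i - 1 + (((k + 1 : ℕ) : ℤ) + 1) = i + S.D i - 1 + (k + 1) + 1 by
            push_cast; ring] at this)
        (by
          rw [show i + S.D i - 1 + ((k : ℤ) + 1) - 1 = i + S.D i - 1 + k by ring]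
          exact_mod_cast hne)
      rw [show i + S.D i - 1 + ((k : ℤ) + 1) - 1 = i + S.D i - 1 + k by ring,
        show i + S.D i - 1 + ((k : ℤ) + 1) + 1 = i + S.D i - 1 + (k + 2 : ℕ) by
          push_cast; ring] at this
      exact this)
    (fun a ha b hb hga hgb => by
      have := hpause (i + S.D i - 1 + (a + 1)) (i + S.D i - 1 + (b + 1)) (by omega)
        (by push_cast; omega) (by omega) (by push_cast; omega)
        (by
          rw [show i + S.D i - 1 + ((a : ℤ) + 1) - 1 = i + S.D i - 1 + a by ring]
          exact_mod_cast hga)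
        (by
          rw [show i + S.D i - 1 + ((b : ℤ) + 1) - 1 = i + S.D i - 1 + b by ring]
          exact_mod_cast hgb)
      omega)
    (by push_cast at h₂; omega)
  simp only [hl, add_sub_cancel] at this
  exact this

/-- Before its crossing, the innermost point moves straight towards the centre. -/
theorem Crosses.path_before {i : ℤ} {p : Fin (2 * n)} (hp : S.Crosses i p) (h : S.u i p = 1)
    {j : ℤ} (h₁ : j ≤ i - S.D i) (h₂ : i - n ≤ j) :
    S.u j p = -(1 + 2 * (i - S.D i - j)) := by
  obtain ⟨p', hp'⟩ := S.conj p
  have e := hp.eq_neg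
  have hr : S.reverse.Crosses (-i) p' := by
    rw [reverse_crosses_iff]
    unfold Crosses at hp ⊢
    rw [hp']
    omega
  have hu : S.reverse.u (-i) p' = 1 := by
    simp only [reverse, hp']
    rw [show -1 - -i = i - 1 by ring]
    omega
  have := hr.path_after hu (j := -1 - j) (by simp only [reverse, neg_neg]; omega) (by omega)
  simp only [reverse, hp', sub_sub_cancel, neg_neg] at this
  omega

end SymmetricSweep

/-! ### From allowable sequences to sweeps -/

namespace IsMove

variable {N : ℕ} {σ τ : Equiv.Perm (Fin N)} {S : Finset (Fin N × Fin N)}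

theorem mem_after (h : IsMove σ τ S) {s : Fin N × Fin N} (hs : s ∈ S) {p : Fin N}
    (hp : σ p ∈ Finset.Icc s.1 s.2) : τ p ∈ Finset.Icc s.1 s.2 := by
  have := h.reverse s hs p hp
  simp only [Finset.mem_Icc, Fin.le_def] at hp ⊢
  omega

theorem side_of_disjoint {s s' : Fin N × Fin N} (hs : s.1 < s.2) (hs' : s'.1 < s'.2)
    (h : Disjoint (Finset.Icc s.1 s.2) (Finset.Icc s'.1 s'.2)) : s.2 < s'.1 ∨ s'.2 < s.1 := by
  by_contra! hc
  rcases le_total s.1 s'.1 with hle | hle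
  · exact Finset.disjoint_left.1 h (Finset.mem_Icc.2 ⟨hle, hc.1⟩)
      (Finset.mem_Icc.2 ⟨le_rfl, hs'.le⟩)
  · exact Finset.disjoint_left.1 h (Finset.mem_Icc.2 ⟨le_rfl, hs.le⟩)
      (Finset.mem_Icc.2 ⟨hle, hc.2⟩)

theorem side_iff (h : IsMove σ τ S) {s : Fin N × Fin N} (hs : s ∈ S) {q : Fin N}
    (hq : σ q ∉ Finset.Icc s.1 s.2) :
    (σ q < s.1 ∧ τ q < s.1) ∨ (s.2 < σ q ∧ s.2 < τ q) := by
  by_cases hex : ∃ s' ∈ S, σ q ∈ Finset.Icc s'.1 s'.2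
  · obtain ⟨s', hs', hq'⟩ := hex
    have hne : s ≠ s' := by
      rintro rfl
      exact hq hq'
    have h₁ := h.mem_after hs' hq'
    rw [Finset.mem_Icc] at h₁ hq'
    rcases side_of_disjoint (h.lt s hs) (h.lt s' hs') (h.disjoint s hs s' hs' hne) with h₂ | h₂
    · exact Or.inr ⟨h₂.trans_le hq'.1, h₂.trans_le h₁.1⟩
    · exact Or.inl ⟨hq'.2.trans_lt h₂, h₁.2.trans_lt h₂⟩
  · push Not at hex
    rw [h.fixed q hex]
    rw [Finset.mem_Icc] at hq
    omega

/-- Two points whose order is reversed by a move belong to a common switch. -/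
theorem exists_switch (h : IsMove σ τ S) {p q : Fin N} (h₁ : σ p < σ q) (h₂ : τ q < τ p) :
    ∃ s ∈ S, σ p ∈ Finset.Icc s.1 s.2 ∧ σ q ∈ Finset.Icc s.1 s.2 := by
  by_cases hp : ∃ s ∈ S, σ p ∈ Finset.Icc s.1 s.2
  · obtain ⟨s, hs, hp⟩ := hp
    refine ⟨s, hs, hp, ?_⟩
    by_contra hq
    have hp' := h.mem_after hs hp
    rw [Finset.mem_Icc] at hp hp'
    rcases h.side_iff hs hq with ⟨h₃, h₄⟩ | ⟨h₃, h₄⟩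
    · exact absurd (h₁.trans h₃) (not_lt.2 hp.1)
    · exact absurd (h₄.trans h₂) (not_lt.2 hp'.2)
  · by_cases hq : ∃ s ∈ S, σ q ∈ Finset.Icc s.1 s.2
    · obtain ⟨s, hs, hq⟩ := hq
      have hq' := h.mem_after hs hq
      push Not at hp
      rw [Finset.mem_Icc] at hq hq'
      rcases h.side_iff hs (hp s hs) with ⟨h₃, h₄⟩ | ⟨h₃, h₄⟩
      · exact absurd (h₂.trans h₄) (not_lt.2 hq'.1)
      · exact absurd (h₃.trans h₁) (not_lt.2 hq.2)
    · push Not at hp hq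
      rw [h.fixed p hp, h.fixed q hq] at h₂
      exact absurd h₁ h₂.asymm

end IsMove

namespace AllowableSequence

variable {n : ℕ} (A : AllowableSequence (2 * n))

/-- The signed, doubled distance of the position of `p` from the centre. -/
def centered (i : ℤ) (p : Fin (2 * n)) : ℤ :=
  2 * (A.pos i p : ℕ) + 1 - 2 * n

open Classical in
/-- Half of the number of points in the crossing switch of move `i`, if there is one. -/
noncomputable def crossingRadius (i : ℤ) : ℤ :=
  -- Positions start at 0, so a centered block beginning at `a` has `2 * n - 2 * a` elements.
  if h : ∃ s ∈ A.move i, IsCrossing s then n - (h.choose.1 : ℕ) else 0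

variable {A}

theorem isCrossing_iff {s : Fin (2 * n) × Fin (2 * n)} :
    IsCrossing s ↔ (s.1 : ℕ) + s.2 + 1 = 2 * n := by
  rw [IsCrossing, Fin.ext_iff, Fin.val_rev]
  omega

theorem crossingRadius_eq {i : ℤ} {s : Fin (2 * n) × Fin (2 * n)} (hs : s ∈ A.move i)
    (hc : IsCrossing s) : A.crossingRadius i = n - (s.1 : ℕ) := by
  have hex : ∃ s ∈ A.move i, IsCrossing s := ⟨s, hs, hc⟩
  rw [crossingRadius, dif_pos hex]
  obtain ⟨hs', hc'⟩ := hex.choose_spec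
  set s' := hex.choose
  by_cases hne : s = s'
  · rw [← hne]
  · exfalso
    have h₁ := (A.isMove i).lt s hs
    have h₂ := (A.isMove i).lt s' hs'
    rw [isCrossing_iff] at hc hc'
    have := IsMove.side_of_disjoint h₁ h₂ ((A.isMove i).disjoint s hs s' hs' hne)
    simp only [Fin.lt_def] at *
    omega

theorem crossingRadius_eq_zero {i : ℤ} (h : ¬ ∃ s ∈ A.move i, IsCrossing s) :
    A.crossingRadius i = 0 := by
  rw [crossingRadius, dif_neg h]

theorem crossingRadius_pos_iff {i : ℤ} :
    0 < A.crossingRadius i ↔ ∃ s ∈ A.move i, IsCrossing s := by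
  constructor
  · intro h
    by_contra hc
    rw [crossingRadius_eq_zero hc] at h
    exact lt_irrefl _ h
  · rintro ⟨s, hs, hc⟩
    rw [crossingRadius_eq hs hc]
    have := (A.isMove i).lt s hs
    rw [isCrossing_iff] at hc
    rw [Fin.lt_def] at this
    omega

theorem two_mul_crossingRadius {i : ℤ} {s : Fin (2 * n) × Fin (2 * n)} (hs : s ∈ A.move i)
    (hc : IsCrossing s) : 2 * A.crossingRadius i = ((Finset.Icc s.1 s.2).card : ℤ) := by
  rw [crossingRadius_eq hs hc, Fin.card_Icc]
  have := (A.isMove i).lt s hs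
  rw [isCrossing_iff] at hc
  rw [Fin.lt_def] at this
  omega

/-- A point lies in the range given by the crossing radius iff it is in the crossing switch. -/
theorem centered_mem_iff {i j : ℤ} {p : Fin (2 * n)} :
    (-(2 * A.crossingRadius i) < A.centered j p ∧ A.centered j p < 2 * A.crossingRadius i) ↔
      ∃ s ∈ A.move i, IsCrossing s ∧ A.pos j p ∈ Finset.Icc s.1 s.2 := by
  constructor
  · intro h
    have hpos : 0 < A.crossingRadius i := by omega
    obtain ⟨s, hs, hc⟩ := crossingRadius_pos_iff.1 hpos
    refine ⟨s, hs, hc, ?_⟩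
    rw [crossingRadius_eq hs hc, centered] at h
    rw [isCrossing_iff] at hc
    rw [Finset.mem_Icc, Fin.le_def, Fin.le_def]
    omega
  · rintro ⟨s, hs, hc, hp⟩
    rw [crossingRadius_eq hs hc, centered]
    rw [isCrossing_iff] at hc
    rw [Finset.mem_Icc, Fin.le_def, Fin.le_def] at hp
    omega

/-- A noncrossing switch is a transposition. It cannot exchange the two central positions, since it
would then be centered; hence it preserves signs. -/
theorem centered_step (hg : A.InNoncentralGeneralPosition) (i : ℤ) (p : Fin (2 * n))
    (h : ¬ (-(2 * A.crossingRadius i) < A.centered (i - 1) p ∧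
      A.centered (i - 1) p < 2 * A.crossingRadius i)) :
    (0 < A.centered (i - 1) p ↔ 0 < A.centered i p) ∧
    (A.centered i p = A.centered (i - 1) p ∨
      ((A.centered i p = A.centered (i - 1) p + 2 ∨
        A.centered i p = A.centered (i - 1) p - 2) ∧
      ∃ q, A.centered (i - 1) q = A.centered i p ∧ A.centered i q = A.centered (i - 1) p)) := by
  by_cases hp : ∃ s ∈ A.move i, A.pos (i - 1) p ∈ Finset.Icc s.1 s.2
  · obtain ⟨s, hs, hp⟩ := hp
    have hc : ¬ IsCrossing s := fun hc => h (centered_mem_iff.2 ⟨s, hs, hc, hp⟩)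
    have h₁ := hg i s hs hc
    have h₂ := (A.isMove i).reverse s hs p hp
    rw [isCrossing_iff] at hc
    have hq : A.pos (i - 1) ((A.pos (i - 1)).symm (A.pos i p)) = A.pos i p :=
      Equiv.apply_symm_apply _ _
    have h₃ := (A.isMove i).reverse s hs ((A.pos (i - 1)).symm (A.pos i p)) (by
      rw [hq]
      exact (A.isMove i).mem_after hs hp)
    rw [hq] at h₃
    rw [Finset.mem_Icc, Fin.le_def, Fin.le_def] at hp
    refine ⟨by unfold centered; omega, Or.inr ⟨by unfold centered; omega,
      (A.pos (i - 1)).symm (A.pos i p), ?_, ?_⟩⟩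
    · unfold centered
      rw [hq]
    · unfold centered
      omega
  · push Not at hp
    have := (A.isMove i).fixed p hp
    unfold centered
    rw [this]
    exact ⟨Iff.rfl, Or.inl rfl⟩

theorem exists_switch_of_inverts {i : ℤ} {p q : Fin (2 * n)}
    (h : (A.centered (i - 1) p < A.centered (i - 1) q ∧ A.centered i q < A.centered i p) ∨
      (A.centered (i - 1) q < A.centered (i - 1) p ∧ A.centered i p < A.centered i q)) :
    ∃ s ∈ A.move i, A.pos (i - 1) p ∈ Finset.Icc s.1 s.2 ∧
      A.pos (i - 1) q ∈ Finset.Icc s.1 s.2 := by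
  unfold centered at h
  rcases h with ⟨h₁, h₂⟩ | ⟨h₁, h₂⟩
  · exact (A.isMove i).exists_switch (by rw [Fin.lt_def]; omega) (by rw [Fin.lt_def]; omega)
  · obtain ⟨s, hs, h₃, h₄⟩ := (A.isMove i).exists_switch (p := q) (q := p)
      (by rw [Fin.lt_def]; omega) (by rw [Fin.lt_def]; omega)
    exact ⟨s, hs, h₄, h₃⟩

theorem centered_anti (hh : A.halfLength = 2 * n) (i : ℤ) (p : Fin (2 * n)) :
    A.centered (i + 2 * n) p = -A.centered i p := by
  have := A.pos_add_halfLength i p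
  rw [hh, Fin.ext_iff, Fin.val_rev] at this
  push_cast at this
  unfold centered
  have := (A.pos i p).2
  omega

theorem inverts_add_mul (hh : A.halfLength = 2 * n) {i : ℤ} {p q : Fin (2 * n)} (k : ℤ) :
    ((A.centered (i + 2 * n * k - 1) p < A.centered (i + 2 * n * k - 1) q ∧
        A.centered (i + 2 * n * k) q < A.centered (i + 2 * n * k) p) ∨
      (A.centered (i + 2 * n * k - 1) q < A.centered (i + 2 * n * k - 1) p ∧
        A.centered (i + 2 * n * k) p < A.centered (i + 2 * n * k) q)) ↔
    ((A.centered (i - 1) p < A.centered (i - 1) q ∧ A.centered i q < A.centered i p) ∨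
      (A.centered (i - 1) q < A.centered (i - 1) p ∧ A.centered i p < A.centered i q)) := by
  have key : ∀ j : ℤ, ((A.centered (j + 2 * n - 1) p < A.centered (j + 2 * n - 1) q ∧
        A.centered (j + 2 * n) q < A.centered (j + 2 * n) p) ∨
      (A.centered (j + 2 * n - 1) q < A.centered (j + 2 * n - 1) p ∧
        A.centered (j + 2 * n) p < A.centered (j + 2 * n) q)) ↔
    ((A.centered (j - 1) p < A.centered (j - 1) q ∧ A.centered j q < A.centered j p) ∨
      (A.centered (j - 1) q < A.centered (j - 1) p ∧ A.centered j p < A.centered j q)) := by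
    intro j
    rw [show j + 2 * n - 1 = j - 1 + 2 * (n : ℤ) by ring]
    simp only [centered_anti hh]
    omega
  induction k using Int.induction_on with
  | zero => simp
  | succ k ih =>
    refine Iff.trans ?_ ih
    rw [← key (i + 2 * n * k),
      show i + 2 * (n : ℤ) * (k + 1) = i + 2 * n * k + 2 * n by ring]
  | pred k ih =>
    refine Iff.trans ?_ ih
    rw [← key (i + 2 * n * (-k - 1)),
      show i + 2 * (n : ℤ) * (-k - 1) + 2 * n = i + 2 * n * -k by ring]

/-- `switch_once` concerns only the moves of the first halfperiod; antiperiodicity carries it to any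
two moves less than a halfperiod apart. -/
theorem inverts_once (hh : A.halfLength = 2 * n) (i j : ℤ) (p q : Fin (2 * n)) (hij : i < j)
    (hji : j < i + 2 * n)
    (hi : (A.centered (i - 1) p < A.centered (i - 1) q ∧ A.centered i q < A.centered i p) ∨
      (A.centered (i - 1) q < A.centered (i - 1) p ∧ A.centered i p < A.centered i q)) :
    ¬ ((A.centered (j - 1) p < A.centered (j - 1) q ∧ A.centered j q < A.centered j p) ∨
      (A.centered (j - 1) q < A.centered (j - 1) p ∧ A.centered j p < A.centered j q)) := by
  intro hj
  have hpq : p ≠ q := by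
    rintro rfl
    omega
  have hn : (0 : ℤ) < 2 * n := by omega
  have shift : ∀ a : ℤ, ∃ k : ℤ, 1 ≤ a + 2 * n * k ∧ a + 2 * n * k ≤ 2 * n := by
    intro a
    refine ⟨-((a - 1) / (2 * n)), ?_⟩
    have h₁ := Int.emod_nonneg (a - 1) hn.ne'
    have h₂ := Int.emod_lt_of_pos (a - 1) hn
    rw [Int.emod_def] at h₁ h₂
    rw [mul_neg]
    omega
  obtain ⟨k, hk₁, hk₂⟩ := shift i
  obtain ⟨l, hl₁, hl₂⟩ := shift j
  rw [← inverts_add_mul hh k] at hi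
  rw [← inverts_add_mul hh l] at hj
  have := (A.switch_once p q hpq).unique
    ⟨⟨hk₁, by rw [hh]; push_cast; omega⟩, exists_switch_of_inverts hi⟩
    ⟨⟨hl₁, by rw [hh]; push_cast; omega⟩, exists_switch_of_inverts hj⟩
  have hkl : j - i = 2 * n * (k - l) := by linarith [mul_sub (2 * (n : ℤ)) k l]
  have h₁ : 0 < k - l := by
    by_contra! h
    nlinarith
  have h₂ : k - l < 1 := by
    by_contra! h
    nlinarith
  omega

/-- The sweep of a centrally symmetric even-near-critical allowable sequence. -/
noncomputable def toSweep (hh : A.halfLength = 2 * n) (hs : A.IsCentrallySymmetric)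
    (hg : A.InNoncentralGeneralPosition) : SymmetricSweep n where
  u := A.centered
  D := A.crossingRadius
  odd i p := by unfold centered; omega
  lower i p := by unfold centered; omega
  upper i p := by
    have := (A.pos i p).2
    unfold centered
    omega
  inj i p q h := (A.pos i).injective (Fin.ext (by unfold centered at h; omega))
  surj i v h₁ h₂ h₃ := by
    refine ⟨(A.pos i).symm ⟨((v + 2 * n - 1) / 2).toNat, by omega⟩, ?_⟩
    unfold centered
    rw [Equiv.apply_symm_apply]
    simp only
    omega
  conj p := by
    obtain ⟨p', hp⟩ := hs p
    refine ⟨p', fun i => ?_⟩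
    have := hp i
    rw [Fin.ext_iff, Fin.val_rev] at this
    have := (A.pos i p).2
    unfold centered
    omega
  anti := centered_anti hh
  D_nonneg i := by
    by_cases h : ∃ s ∈ A.move i, IsCrossing s
    · exact (crossingRadius_pos_iff.2 h).le
    · rw [crossingRadius_eq_zero h]
  D_le i := by
    by_cases h : ∃ s ∈ A.move i, IsCrossing s
    · obtain ⟨s, hs, hc⟩ := h
      rw [crossingRadius_eq hs hc]
      omega
    · rw [crossingRadius_eq_zero h]
      omega
  cross i p h₁ h₂ := by
    obtain ⟨s, hs, hc, hp⟩ := centered_mem_iff.1 ⟨h₁, h₂⟩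
    have := (A.isMove i).reverse s hs p hp
    rw [isCrossing_iff] at hc
    unfold centered
    omega
  step := centered_step hg
  once := inverts_once hh

end AllowableSequence

/-! ### Inversions forced by radii 2, 1, 2 -/

namespace SymmetricSweep

variable {n : ℕ} {S : SymmetricSweep n}

variable (S) in
/-- The conjugate of a point. -/
noncomputable def bar (p : Fin (2 * n)) : Fin (2 * n) :=
  (S.conj p).choose

@[simp]
theorem u_bar (i : ℤ) (p : Fin (2 * n)) : S.u i (S.bar p) = -S.u i p :=
  (S.conj p).choose_spec i

@[simp]
theorem bar_bar (p : Fin (2 * n)) : S.bar (S.bar p) = p :=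
  S.inj 0 _ _ (by simp)

@[simp]
theorem crosses_bar {i : ℤ} {p : Fin (2 * n)} : S.Crosses i (S.bar p) ↔ S.Crosses i p := by
  simp only [Crosses, u_bar]
  omega

theorem Crosses.inverts_bar {i : ℤ} {p : Fin (2 * n)} (h : S.Crosses i p) :
    S.Inverts i p (S.bar p) :=
  (crosses_iff_inverts fun i => S.u_bar i p).1 h

theorem inverts_bar_bar {i : ℤ} {p q : Fin (2 * n)} :
    S.Inverts i (S.bar p) (S.bar q) ↔ S.Inverts i p q := by
  simp only [Inverts, u_bar]
  omega

theorem Crosses.not_crosses_of_ne {i j : ℤ} {p : Fin (2 * n)} (hp : S.Crosses i p) (hij : i ≠ j)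
    (h₁ : i - j < 2 * n) (h₂ : j - i < 2 * n) : ¬ S.Crosses j p :=
  fun h => hij (hp.unique h h₁ h₂)

theorem exchange_of {i j v w : ℤ} {p q : Fin (2 * n)} (hc : ¬ S.Crosses i p) (hij : j + 1 = i)
    (hv : S.u j p = v) (hw : S.u i p = w) (hvw : v ≠ w) (hq : S.u j q = w) :
    S.u i q = v ∧ S.Inverts i p q := by
  obtain rfl : j = i - 1 := by omega
  have := exchange hc (by omega) (q := q) (by omega)
  rwa [hv] at this

/-- The inversions forced by three consecutive crossing switches of `4`, `2` and `4` points. -/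
theorem exists_core {τ : ℤ} (h0 : S.D τ = 2) (h3 : S.D (τ + 3) = 1) (h6 : S.D (τ + 6) = 2)
    (hn : 5 ≤ n) : ∃ a b x y z : Fin (2 * n),
      (S.Crosses τ a ∧ S.u τ a = 1 ∧ S.Crosses τ b ∧ S.u (τ + 3) b = 9) ∧
      (S.Crosses (τ + 3) x ∧ S.u (τ + 3) x = -1) ∧
      (S.Crosses (τ + 6) y ∧ S.Crosses (τ + 6) z ∧ S.u (τ + 6) z = -3) ∧
      (S.Inverts (τ + 2) a x ∧ S.Inverts (τ + 2) b y) ∧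
      (S.Inverts (τ + 3) a y ∧ S.Inverts (τ + 3) b z) ∧
      S.Inverts (τ + 4) a z ∧
      S.Inverts (τ + 5) (S.bar x) z := by
  obtain ⟨a, ha, ha1⟩ := exists_crosses_one (S := S) (i := τ) (by omega)
  obtain ⟨x', hx, hx1⟩ := exists_crosses_one (S := S) (i := τ + 3) (by omega)
  obtain ⟨y', hy, hy1⟩ := exists_crosses_one (S := S) (i := τ + 6) (by omega)
  obtain ⟨b, hb0⟩ := S.surj τ 3 (by omega) (by omega) (by omega)
  have hb : S.Crosses τ b := crosses_iff_after.2 (by omega)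
  have na : ∀ k, 0 < k → k < 10 → ¬ S.Crosses (τ + k) a := fun k h₁ h₂ =>
    ha.not_crosses_of_ne (by omega) (by omega) (by omega)
  have nb : ∀ k, 0 < k → k < 10 → ¬ S.Crosses (τ + k) b := fun k h₁ h₂ =>
    hb.not_crosses_of_ne (by omega) (by omega) (by omega)
  have nx : ∀ k, -7 < k → k < 13 → k ≠ 3 → ¬ S.Crosses (τ + k) x' := fun k h₁ h₂ h₃ =>
    hx.not_crosses_of_ne (by omega) (by omega) (by omega)
  have ny : ∀ k, -4 < k → k < 6 → ¬ S.Crosses (τ + k) y' := fun k h₁ h₂ =>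
    hy.not_crosses_of_ne (by omega) (by omega) (by omega)
  have ua : ∀ k, 1 ≤ k → k ≤ 4 → S.u (τ + k) a = 2 * k - 1 := fun k h₁ h₂ => by
    have := ha.path_after ha1 (j := τ + k) (by omega) (by omega)
    omega
  have ux : ∀ k, 3 ≤ k → k ≤ 7 → S.u (τ + k) x' = 2 * k - 5 := fun k h₁ h₂ => by
    have := hx.path_after hx1 (j := τ + k) (by omega) (by omega)
    omega
  have ux' : ∀ k, 0 ≤ k → k ≤ 2 → S.u (τ + k) x' = 2 * k - 5 := fun k h₁ h₂ => by
    have := hx.path_before hx1 (j := τ + k) (by omega) (by omega)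
    omega
  have uy : ∀ k, 1 ≤ k → k ≤ 4 → S.u (τ + k) y' = 2 * k - 9 := fun k h₁ h₂ => by
    have := hy.path_before hy1 (j := τ + k) (by omega) (by omega)
    omega
  -- The conjugate of `x'` comes in from `5` to `3` and pushes `b` outwards.
  have ub1 : S.u (τ + 1) b = 5 :=
    (exchange_of (p := S.bar x') (crosses_bar.not.2 (nx 1 (by omega) (by omega) (by omega)))
      (j := τ) (w := 3) (by ring) (by have := ux' 0; simp_all) (by have := ux' 1; simp_all)
      (by omega) hb0).1
  have iax : S.Inverts (τ + 2) a (S.bar x') :=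
    (exchange_of (na 2 (by omega) (by omega)) (j := τ + 1) (by ring) (ua 1 (by omega) (by omega))
      (ua 2 (by omega) (by omega)) (by omega) (by rw [u_bar, ux' 1 (by omega) (by omega)]; rfl)).2
  obtain ⟨ub2, iyb⟩ := exchange_of (p := S.bar y') (q := b) (v := 7) (w := 5)
    (crosses_bar.not.2 (ny 2 (by omega) (by omega))) (j := τ + 1) (by ring)
    (by rw [u_bar, uy 1 (by omega) (by omega)]; rfl)
    (by rw [u_bar, uy 2 (by omega) (by omega)]; rfl) (by omega) ub1
  have iay : S.Inverts (τ + 3) a (S.bar y') :=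
    (exchange_of (na 3 (by omega) (by omega)) (j := τ + 2) (by ring) (ua 2 (by omega) (by omega))
      (ua 3 (by omega) (by omega)) (by omega) (by rw [u_bar, uy 2 (by omega) (by omega)]; rfl)).2
  -- The point at `7` is pushed inwards by `a`, then by `x'`, and so reaches `3`, inside the block
  -- of the crossing `τ + 6`.
  obtain ⟨z, uz3⟩ := S.surj (τ + 3) 7 (by omega) (by omega) (by omega)
  obtain ⟨uz4, iaz⟩ := exchange_of (na 4 (by omega) (by omega)) (j := τ + 3) (by ring)
    (ua 3 (by omega) (by omega)) (ua 4 (by omega) (by omega)) (by omega) uz3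
  obtain ⟨uz5, ixz⟩ := exchange_of (nx 5 (by omega) (by omega) (by omega)) (j := τ + 4) (by ring)
    (ux 4 (by omega) (by omega)) (ux 5 (by omega) (by omega)) (by omega) uz4
  have hz : S.Crosses (τ + 6) z := by
    unfold Crosses
    rw [show τ + 6 - 1 = τ + 5 by ring]
    omega
  have uz6 : S.u (τ + 6) z = -3 := by
    rw [hz.eq_neg, show τ + 6 - 1 = τ + 5 by ring, uz5]
    rfl
  have hab : a ≠ b := by
    rintro rfl
    omega
  -- From `7`, the place `5` is taken by `a`; staying at `7` would make `b` the point `z`, inverted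
  -- with `a` again in move `τ + 4`.
  have ub3 : S.u (τ + 3) b = 9 := by
    have h₁ := step_le (nb 3 (by omega) (by omega))
    rw [show τ + 3 - 1 = τ + 2 by ring, ub2] at h₁
    have h₂ : S.u (τ + 3) b ≠ 5 := fun h =>
      hab (S.inj (τ + 3) _ _ ((ua 3 (by omega) (by omega)).trans h.symm))
    have h₃ : S.u (τ + 3) b ≠ 7 := by
      intro h
      obtain rfl : b = z := S.inj (τ + 3) _ _ (h.trans uz3.symm)
      have := (ha.inverts hb hab).unique iaz (by omega) (by omega)
      omega
    omega
  have ibz : S.Inverts (τ + 3) b z := by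
    obtain ⟨q, hq⟩ := S.surj (τ + 2) 9 (by omega) (by omega) (by omega)
    obtain ⟨hq', h⟩ := exchange_of (nb 3 (by omega) (by omega)) (j := τ + 2) (by ring) ub2 ub3
      (by omega) hq
    rwa [S.inj (τ + 3) z q (uz3.trans hq'.symm)]
  refine ⟨a, b, S.bar x', S.bar y', z, ⟨ha, ha1, hb, ub3⟩, ⟨crosses_bar.2 hx, by simp [hx1]⟩,
    ⟨crosses_bar.2 hy, hz, uz6⟩, ⟨iax, iyb.symm⟩, ⟨iay, ibz⟩, iaz, ?_⟩
  rwa [bar_bar]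

end SymmetricSweep

/-! ### Parallelisms in coordinates -/

/-- The determinant of two vectors of the plane. -/
def planeDet (v w : ℝ × ℝ) : ℝ :=
  v.1 * w.2 - v.2 * w.1

theorem eq_smul_of_planeDet {a y v : ℝ × ℝ} (h : planeDet a y ≠ 0) :
    v = (planeDet v y / planeDet a y) • a + (planeDet a v / planeDet a y) • y := by
  ext
  · simp only [Prod.fst_add, Prod.smul_fst, smul_eq_mul]
    field_simp
    unfold planeDet
    ring
  · simp only [Prod.snd_add, Prod.smul_snd, smul_eq_mul]
    field_simp
    unfold planeDet
    ring

theorem planeDet_comb (a y : ℝ × ℝ) (r s r' s' : ℝ) :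
    planeDet (r • a + s • y) (r' • a + s' • y) = (r * s' - s * r') * planeDet a y := by
  simp only [planeDet, Prod.fst_add, Prod.snd_add, Prod.smul_fst, Prod.smul_snd, smul_eq_mul]
  ring

/-- The parallelisms of `SymmetricSweep.exists_core` in coordinates with respect to `a`, `y`. -/
theorem core_coordinates {a b x y z : ℝ × ℝ} (hay : planeDet a y ≠ 0) (hab : planeDet a b = 0)
    (hyz : planeDet y z = 0) (h₂ : planeDet (a - x) (b - y) = 0) (h₃ : planeDet x (a - y) = 0)
    (h₃' : planeDet x (b - z) = 0) :
    ∃ k l : ℝ, k * (1 - l) = 1 ∧ x = k • a + (-k) • y ∧ b = l • a ∧ z = l • y := by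
  have hb := eq_smul_of_planeDet (v := b) hay
  have hz := eq_smul_of_planeDet (v := z) hay
  have hx := eq_smul_of_planeDet (v := x) hay
  have hzy : planeDet z y = 0 := by
    unfold planeDet at hyz ⊢
    linarith
  rw [hab, zero_div, zero_smul, add_zero] at hb
  rw [hzy, zero_div, zero_smul, zero_add] at hz
  generalize planeDet b y / planeDet a y = l at hb
  generalize planeDet a z / planeDet a y = m at hz
  generalize planeDet x y / planeDet a y = k at hx
  generalize planeDet a x / planeDet a y = k' at hx
  subst hb hz hx
  have e₂ := planeDet_comb a y (1 - k) (-k') l (-1)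
  rw [show (1 - k) • a + -k' • y = a - (k • a + k' • y) by module,
    show l • a + (-1 : ℝ) • y = l • a - y by module, h₂] at e₂
  have e₃ := planeDet_comb a y k k' 1 (-1)
  rw [show (1 : ℝ) • a + (-1 : ℝ) • y = a - y by module, h₃] at e₃
  have e₄ := planeDet_comb a y k k' l (-m)
  rw [show l • a + -m • y = l • a - m • y by module, h₃'] at e₄
  have f₂ := (mul_eq_zero.1 e₂.symm).resolve_right hay
  have f₃ := (mul_eq_zero.1 e₃.symm).resolve_right hay
  have f₄ := (mul_eq_zero.1 e₄.symm).resolve_right hay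
  obtain rfl : k' = -k := by linarith
  have hk : k * (1 - l) = 1 := by linarith
  have hk0 : k ≠ 0 := left_ne_zero_of_mul_eq_one hk
  have : m = l := by
    apply mul_left_cancel₀ hk0
    linarith
  exact ⟨k, l, hk, rfl, rfl, by rw [this]⟩

/-- Write `w = r • a + s • y`. Then `h₆` gives `r = -k`, `h₄` gives `s = l * (l + k)`, and with `k *
l = k - 1` the relation `h₅` collapses to `2 = 0`. -/
theorem core_false_of_outer {a b x y z w : ℝ × ℝ} (hay : planeDet a y ≠ 0)
    (hab : planeDet a b = 0) (hyz : planeDet y z = 0) (h₂ : planeDet (a - x) (b - y) = 0)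
    (h₃ : planeDet x (a - y) = 0) (h₃' : planeDet x (b - z) = 0)
    (h₄ : planeDet (a - z) (b - w) = 0) (h₅ : planeDet (x + z) (a - w) = 0)
    (h₆ : planeDet y (x + w) = 0) : False := by
  obtain ⟨k, l, hk, rfl, rfl, rfl⟩ := core_coordinates hay hab hyz h₂ h₃ h₃'
  have hw := eq_smul_of_planeDet (v := w) hay
  generalize planeDet w y / planeDet a y = r at hw
  generalize planeDet a w / planeDet a y = s at hw
  subst hw
  have e₄ := planeDet_comb a y 1 (-l) (l - r) (-s)
  rw [show (1 : ℝ) • a + -l • y = a - l • y by module,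
    show (l - r) • a + -s • y = l • a - (r • a + s • y) by module, h₄] at e₄
  have e₅ := planeDet_comb a y k (l - k) (1 - r) (-s)
  rw [show k • a + (l - k) • y = k • a + -k • y + l • y by module,
    show (1 - r) • a + -s • y = a - (r • a + s • y) by module, h₅] at e₅
  have e₆ := planeDet_comb a y 0 1 (k + r) (s - k)
  rw [show (0 : ℝ) • a + (1 : ℝ) • y = y by module,
    show (k + r) • a + (s - k) • y = k • a + -k • y + (r • a + s • y) by module, h₆] at e₆
  have f₄ := (mul_eq_zero.1 e₄.symm).resolve_right hay
  have f₅ := (mul_eq_zero.1 e₅.symm).resolve_right hay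
  have f₆ := (mul_eq_zero.1 e₆.symm).resolve_right hay
  obtain rfl : r = -k := by linarith
  obtain rfl : s = l * (l + k) := by linarith
  have hkl : k * l = k - 1 := by linarith
  have : (2 : ℝ) = 0 := by linear_combination f₅ + (l + k + 2) * hkl
  norm_num at this

/-- Here `a` takes the role of `w`. The relation `h₆` forces `k = -1`, hence `l = 2`, and then `a +
z` and `x + b` are not parallel. -/
theorem core_false_of_closed {a b x y z : ℝ × ℝ} (hay : planeDet a y ≠ 0)
    (hab : planeDet a b = 0) (hyz : planeDet y z = 0) (h₂ : planeDet (a - x) (b - y) = 0)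
    (h₃ : planeDet x (a - y) = 0) (h₃' : planeDet x (b - z) = 0)
    (h₆ : planeDet y (x + a) = 0) (h₇ : planeDet (a + z) (x + b) = 0) : False := by
  obtain ⟨k, l, hk, rfl, rfl, rfl⟩ := core_coordinates hay hab hyz h₂ h₃ h₃'
  have e₆ := planeDet_comb a y 0 1 (k + 1) (-k)
  rw [show (0 : ℝ) • a + (1 : ℝ) • y = y by module,
    show (k + 1) • a + -k • y = k • a + -k • y + a by module, h₆] at e₆
  have e₇ := planeDet_comb a y 1 l (k + l) (-k)
  rw [show (1 : ℝ) • a + l • y = a + l • y by module,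
    show (k + l) • a + -k • y = k • a + -k • y + l • a by module, h₇] at e₇
  have f₆ := (mul_eq_zero.1 e₆.symm).resolve_right hay
  have f₇ := (mul_eq_zero.1 e₇.symm).resolve_right hay
  obtain rfl : k = -1 := by linarith
  obtain rfl : l = 2 := by linarith
  norm_num at f₇

/-! ### Rotating projections and realizations -/

theorem directionalProj_add_pi (θ : ℝ) (x : ℝ × ℝ) :
    directionalProj (θ + Real.pi) x = -directionalProj θ x := by
  simp only [directionalProj, Real.cos_add_pi, Real.sin_add_pi]
  ring

theorem continuous_directionalProj (x : ℝ × ℝ) : Continuous fun θ => directionalProj θ x := by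
  unfold directionalProj
  fun_prop

theorem nonpos_of_nonpos_Ioo {f : ℝ → ℝ} (hf : Continuous f) {a b : ℝ} (hab : a < b)
    (h : ∀ θ, a < θ → θ < b → f θ ≤ 0) : f a ≤ 0 ∧ f b ≤ 0 := by
  have hsub : closure (Set.Ioo a b) ⊆ {θ | f θ ≤ 0} :=
    closure_minimal (fun θ hθ => h θ hθ.1 hθ.2) (isClosed_le hf continuous_const)
  rw [closure_Ioo hab.ne] at hsub
  exact ⟨hsub (Set.left_mem_Icc.2 hab.le), hsub (Set.right_mem_Icc.2 hab.le)⟩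

theorem planeDet_eq_zero_of_proj {θ : ℝ} {v w : ℝ × ℝ} (hv : directionalProj θ v = 0)
    (hw : directionalProj θ w = 0) : planeDet v w = 0 := by
  unfold directionalProj at hv hw
  have h := Real.cos_sq_add_sin_sq θ
  unfold planeDet
  by_contra hne
  have h₁ : (v.1 * w.2 - v.2 * w.1) * Real.cos θ = 0 := by
    linear_combination w.2 * hv - v.2 * hw
  have h₂ : (v.1 * w.2 - v.2 * w.1) * Real.sin θ = 0 := by
    linear_combination v.1 * hw - w.1 * hv
  rw [(mul_eq_zero.1 h₁).resolve_left hne, (mul_eq_zero.1 h₂).resolve_left hne] at h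
  norm_num at h

theorem sin_sub_eq_zero_of_planeDet {θ φ : ℝ} {v w : ℝ × ℝ} (hv0 : v ≠ 0) (hw0 : w ≠ 0)
    (hv : directionalProj θ v = 0) (hw : directionalProj φ w = 0) (h : planeDet v w = 0) :
    Real.sin (φ - θ) = 0 := by
  unfold directionalProj at hv hw
  unfold planeDet at h
  have hw' : w.1 * Real.cos θ + w.2 * Real.sin θ = 0 := by
    by_contra hne
    apply hv0
    have h₁ : v.1 * (w.1 * Real.cos θ + w.2 * Real.sin θ) = 0 := by
      linear_combination w.1 * hv + Real.sin θ * h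
    have h₂ : v.2 * (w.1 * Real.cos θ + w.2 * Real.sin θ) = 0 := by
      linear_combination w.2 * hv - Real.cos θ * h
    exact Prod.ext ((mul_eq_zero.1 h₁).resolve_right hne) ((mul_eq_zero.1 h₂).resolve_right hne)
  rw [Real.sin_sub]
  by_contra hne
  apply hw0
  have h₁ : w.1 * (Real.sin φ * Real.cos θ - Real.cos φ * Real.sin θ) = 0 := by
    linear_combination Real.sin φ * hw' - Real.sin θ * hw
  have h₂ : w.2 * (Real.sin φ * Real.cos θ - Real.cos φ * Real.sin θ) = 0 := by
    linear_combination Real.cos θ * hw - Real.cos φ * hw'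
  exact Prod.ext ((mul_eq_zero.1 h₁).resolve_right hne) ((mul_eq_zero.1 h₂).resolve_right hne)

theorem directionalProj_sub (θ : ℝ) (x y : ℝ × ℝ) :
    directionalProj θ (x - y) = directionalProj θ x - directionalProj θ y := by
  simp only [directionalProj, Prod.fst_sub, Prod.snd_sub]
  ring

namespace AllowableSequence

variable {n : ℕ} {A : AllowableSequence (2 * n)} {hh : A.halfLength = 2 * n}
  {hs : A.IsCentrallySymmetric} {hg : A.InNoncentralGeneralPosition}

theorem toSweep_lt_iff {i : ℤ} {p q : Fin (2 * n)} :
    (A.toSweep hh hs hg).u i p < (A.toSweep hh hs hg).u i q ↔ A.pos i p < A.pos i q := by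
  simp only [toSweep, centered, Fin.lt_def]
  omega

theorem exists_toSweep_inverts (i : ℤ) :
    ∃ p q, p ≠ q ∧ (A.toSweep hh hs hg).Inverts i p q := by
  obtain ⟨s, hsm⟩ := (A.isMove i).nonempty
  have hlt := (A.isMove i).lt s hsm
  have h₁ := (A.isMove i).reverse s hsm ((A.pos (i - 1)).symm s.1)
  have h₂ := (A.isMove i).reverse s hsm ((A.pos (i - 1)).symm s.2)
  rw [Equiv.apply_symm_apply, Finset.mem_Icc] at h₁ h₂
  have h₁ := h₁ ⟨le_rfl, hlt.le⟩
  have h₂ := h₂ ⟨hlt.le, le_rfl⟩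
  refine ⟨(A.pos (i - 1)).symm s.1, (A.pos (i - 1)).symm s.2, ?_, Or.inl ⟨?_, ?_⟩⟩
  · exact fun h => hlt.ne ((A.pos (i - 1)).symm.injective h)
  · rw [toSweep_lt_iff]
    simpa using hlt
  · rw [toSweep_lt_iff]
    rw [Fin.lt_def] at hlt ⊢
    omega

section Realization

variable {P : Fin (2 * n) → ℝ × ℝ} {α : ℤ → ℝ}

/-- The difference of the projections is continuous in the angle and has opposite signs on the two
sides of `α i`. -/
theorem proj_eq_of_inverts (hα : StrictMono α)
    (hord : ∀ i θ, α i < θ → θ < α (i + 1) → ∀ p q,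
      directionalProj θ (P p) < directionalProj θ (P q) ↔ A.pos i p < A.pos i q)
    {i : ℤ} {p q : Fin (2 * n)} (h : (A.toSweep hh hs hg).Inverts i p q) :
    directionalProj (α i) (P p - P q) = 0 := by
  wlog hpq : A.pos (i - 1) p < A.pos (i - 1) q ∧ A.pos i q < A.pos i p generalizing p q
  · have h' := this h.symm (by
      rw [SymmetricSweep.Inverts] at h
      simp only [toSweep_lt_iff] at h
      exact h.resolve_left hpq)
    rw [directionalProj_sub] at h' ⊢
    linarith
  have hc : Continuous fun θ => directionalProj θ (P p) - directionalProj θ (P q) :=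
    (continuous_directionalProj _).sub (continuous_directionalProj _)
  have h₁ := (nonpos_of_nonpos_Ioo hc (hα (sub_one_lt i)) fun θ h₁ h₂ => by
    have := (hord (i - 1) θ h₁ (by rwa [sub_add_cancel]) p q).2 hpq.1
    linarith).2
  have hc' : Continuous fun θ => directionalProj θ (P q) - directionalProj θ (P p) :=
    (continuous_directionalProj _).sub (continuous_directionalProj _)
  have h₂ := (nonpos_of_nonpos_Ioo hc' (hα (lt_add_one i)) fun θ h₁ h₂ => by
    have := (hord i θ h₁ h₂ q p).2 hpq.2
    linarith).1
  rw [directionalProj_sub]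
  linarith

/-- Pairs of points inverted by different moves of a halfperiod span different directions. -/
theorem planeDet_ne_zero (hP : Function.Injective P) (hα : StrictMono α)
    (hrange : Set.range α = {θ | ∃ p q, p ≠ q ∧
      directionalProj θ (P p) = directionalProj θ (P q)})
    (hord : ∀ i θ, α i < θ → θ < α (i + 1) → ∀ p q,
      directionalProj θ (P p) < directionalProj θ (P q) ↔ A.pos i p < A.pos i q)
    {i j : ℤ} {p q r s : Fin (2 * n)} (hij : i < j) (hji : j < i + 2 * n)
    (hi : (A.toSweep hh hs hg).Inverts i p q) (hj : (A.toSweep hh hs hg).Inverts j r s) :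
    planeDet (P p - P q) (P r - P s) ≠ 0 := by
  intro hdet
  have ne_of : ∀ {k : ℤ} {v w : Fin (2 * n)}, (A.toSweep hh hs hg).Inverts k v w → v ≠ w := by
    rintro k v w h rfl
    unfold SymmetricSweep.Inverts at h
    omega
  have hpi := proj_eq_of_inverts hα hord hi
  have hpj := proj_eq_of_inverts hα hord hj
  have hsin := sin_sub_eq_zero_of_planeDet (sub_ne_zero.2 (hP.ne (ne_of hi)))
    (sub_ne_zero.2 (hP.ne (ne_of hj))) hpi hpj hdet
  obtain ⟨k, hk⟩ := Real.sin_eq_zero_iff.1 hsin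
  have hlt := hα hij
  have hk1 : 1 ≤ k := by
    by_contra! hk0
    have : (k : ℝ) ≤ 0 := by exact_mod_cast (by omega : k ≤ 0)
    nlinarith [Real.pi_pos]
  have hk1' : (1 : ℝ) ≤ k := by exact_mod_cast hk1
  have hle : α i + Real.pi ≤ α j := by nlinarith [Real.pi_pos]
  -- Parallel directions put `α j` at least half a turn after `α i`; half a turn after `α i` there
  -- is an event `α m` with `i < m ≤ j`, after which the order is reversed.
  obtain ⟨m, hm⟩ : α i + Real.pi ∈ Set.range α := by
    rw [hrange]
    refine ⟨p, q, ne_of hi, ?_⟩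
    rw [directionalProj_sub] at hpi
    rw [directionalProj_add_pi, directionalProj_add_pi]
    linarith
  have him : i < m := hα.lt_iff_lt.1 (by linarith [Real.pi_pos])
  have hmj : m ≤ j := hα.le_iff_le.1 (by linarith)
  have hrev : ∀ v w, A.pos i v < A.pos i w ↔ A.pos m w < A.pos m v := by
    intro v w
    have h₁ := hα (lt_add_one i)
    have h₂ := hα (lt_add_one m)
    obtain ⟨θ, hθ₁, hθ₂⟩ := exists_between
      (lt_min h₁ (show α i < α (m + 1) - Real.pi by linarith))
    rw [lt_min_iff] at hθ₂
    rw [← hord i θ hθ₁ hθ₂.1, ← hord m (θ + Real.pi) (by linarith) (by linarith),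
      directionalProj_add_pi, directionalProj_add_pi, neg_lt_neg_iff]
  -- Permutations `m` and `i + 2 * n` agree, both being the reversal of permutation `i`. What move
  -- `m + 1` inverts would have to be inverted back by move `i + 2 * n`, within the same halfperiod.
  obtain ⟨v, w, hvw, hinv⟩ := exists_toSweep_inverts (hh := hh) (hs := hs) (hg := hg) (m + 1)
  obtain ⟨l, hl₁, hl₂, hl⟩ := SymmetricSweep.Inverts.exists_between
    (S := A.toSweep hh hs hg) (a := m + 1) (p := v) (q := w) (i + 2 * n - (m + 1)).toNat (by
      rw [Int.toNat_of_nonneg (by omega), add_sub_cancel, SymmetricSweep.anti,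
        SymmetricSweep.anti]
      have h₁ := hrev v w
      have h₂ := hrev w v
      rw [← toSweep_lt_iff (hh := hh) (hs := hs) (hg := hg),
        ← toSweep_lt_iff (hh := hh) (hs := hs) (hg := hg)] at h₁ h₂
      rw [SymmetricSweep.Inverts, add_sub_cancel_right] at hinv
      omega)
  rw [Int.toNat_of_nonneg (by omega)] at hl₂
  have := hinv.unique hl (by omega) (by omega)
  omega

theorem planeDet_eq_zero (hα : StrictMono α)
    (hord : ∀ i θ, α i < θ → θ < α (i + 1) → ∀ p q,
      directionalProj θ (P p) < directionalProj θ (P q) ↔ A.pos i p < A.pos i q)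
    {i : ℤ} {p q r s : Fin (2 * n)}
    (h : (A.toSweep hh hs hg).Inverts i p q) (h' : (A.toSweep hh hs hg).Inverts i r s) :
    planeDet (P p - P q) (P r - P s) = 0 :=
  planeDet_eq_zero_of_proj (proj_eq_of_inverts hα hord h) (proj_eq_of_inverts hα hord h')

/-- Two pairs of conjugate points which cross at different moves are the diagonals of a
parallelogram. -/
theorem add_bar_eq (hP : Function.Injective P) (hα : StrictMono α)
    (hrange : Set.range α = {θ | ∃ p q, p ≠ q ∧
      directionalProj θ (P p) = directionalProj θ (P q)})
    (hord : ∀ i θ, α i < θ → θ < α (i + 1) → ∀ p q,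
      directionalProj θ (P p) < directionalProj θ (P q) ↔ A.pos i p < A.pos i q)
    {i j : ℤ} {p q : Fin (2 * n)} (hij : i < j) (hji : j < i + 2 * n)
    (hi : (A.toSweep hh hs hg).Crosses i p) (hj : (A.toSweep hh hs hg).Crosses j q) :
    P p + P ((A.toSweep hh hs hg).bar p) = P q + P ((A.toSweep hh hs hg).bar q) := by
  set S := A.toSweep hh hs hg
  have hne := planeDet_ne_zero hP hα hrange hord hij hji hi.inverts_bar hj.inverts_bar
  have hcj : ¬ S.Crosses j p := hi.not_crosses hij hji
  have hpq : p ≠ q := by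
    rintro rfl
    exact hcj hj
  have hpq' : p ≠ S.bar q := by
    rintro rfl
    exact hcj (SymmetricSweep.crosses_bar.2 hj)
  obtain ⟨k, -, -, hk⟩ := S.exists_inverts hpq 0
  obtain ⟨l, -, -, hl⟩ := S.exists_inverts hpq' 0
  have e₁ := planeDet_eq_zero hα hord hk (SymmetricSweep.inverts_bar_bar.2 hk)
  have e₂ := planeDet_eq_zero hα hord hl (SymmetricSweep.inverts_bar_bar.2 hl)
  rw [SymmetricSweep.bar_bar] at e₂
  generalize P (S.bar p) = p' at *
  generalize P (S.bar q) = q' at *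
  generalize P p = p at *
  generalize P q = q at *
  simp only [planeDet, Prod.fst_sub, Prod.snd_sub] at hne e₁ e₂
  -- Opposite sides of the quadrilateral are parallel, so the difference of the sums of the
  -- conjugate pairs is parallel to both diagonals. As these are not parallel, it vanishes.
  have f₁ : (p.1 + p'.1 - (q.1 + q'.1)) * (p.2 - p'.2) -
      (p.2 + p'.2 - (q.2 + q'.2)) * (p.1 - p'.1) = 0 := by
    linear_combination -e₁ - e₂
  have f₂ : (p.1 + p'.1 - (q.1 + q'.1)) * (q.2 - q'.2) -
      (p.2 + p'.2 - (q.2 + q'.2)) * (q.1 - q'.1) = 0 := by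
    linear_combination e₁ - e₂
  refine Prod.ext ?_ ?_
  · apply sub_eq_zero.1
    apply (mul_eq_zero.1 (_ : _ * ((p.1 - p'.1) * (q.2 - q'.2) -
      (p.2 - p'.2) * (q.1 - q'.1)) = 0)).resolve_right hne
    simp only [Prod.fst_add]
    linear_combination (p.1 - p'.1) * f₂ - (q.1 - q'.1) * f₁
  · apply sub_eq_zero.1
    apply (mul_eq_zero.1 (_ : _ * ((p.1 - p'.1) * (q.2 - q'.2) -
      (p.2 - p'.2) * (q.1 - q'.1)) = 0)).resolve_right hne
    simp only [Prod.snd_add]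
    linear_combination (p.2 - p'.2) * f₂ - (q.2 - q'.2) * f₁

end Realization

end AllowableSequence

/-! ### Inversions forced by the next crossing -/

namespace SymmetricSweep

variable {n : ℕ} {S : SymmetricSweep n}

/-- If the crossing after the three crossings of `exists_core` belongs to other points, its
innermost point `w` meets three points of the core. -/
theorem exists_outer {τ d : ℤ} {a b x : Fin (2 * n)} (h0 : S.D τ = 2) (h3 : S.D (τ + 3) = 1)
    (hd : S.D (τ + 8 + d) = d) (hd0 : 0 < d) (hn : 5 + d ≤ n) (ha : S.Crosses τ a)
    (ha1 : S.u τ a = 1) (hb : S.u (τ + 3) b = 9) (hx : S.Crosses (τ + 3) x)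
    (hx1 : S.u (τ + 3) x = -1) :
    ∃ w, S.Crosses (τ + 8 + d) w ∧ S.Inverts (τ + 4) b w ∧ S.Inverts (τ + 5) a w ∧
      S.Inverts (τ + 6) (S.bar x) w := by
  obtain ⟨w, hw, hw1⟩ := exists_crosses_one (S := S) (i := τ + 8 + d) (by omega)
  -- The bound `5 + d ≤ n` ensures that the inward path is already straight at time `τ + 3`; it then
  -- meets `b` at `9`, `a` at `7` and the conjugate of `x` at `5`.
  have uw : ∀ k, 3 ≤ k → k ≤ 8 → S.u (τ + k) (S.bar w) = 17 - 2 * k := fun k h₁ h₂ => by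
    have := hw.path_before hw1 (j := τ + k) (by omega) (by omega)
    rw [u_bar]
    omega
  have nw : ∀ k, 3 ≤ k → k ≤ 8 → ¬ S.Crosses (τ + k) (S.bar w) := fun k h₁ h₂ =>
    (crosses_bar.2 hw).not_crosses_of_ne (by omega) (by omega) (by omega)
  have ua : S.u (τ + 4) a = 7 := by
    have := ha.path_after ha1 (j := τ + 4) (by omega) (by omega)
    omega
  have ux : S.u (τ + 5) (S.bar x) = 5 := by
    have := (crosses_bar.2 hx).path_after (by rw [u_bar, hx1]; rfl) (j := τ + 5) (by omega)
      (by omega)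
    omega
  refine ⟨S.bar w, crosses_bar.2 hw, ?_, ?_, ?_⟩
  · exact (exchange_of (nw 4 (by omega) (by omega)) (j := τ + 3) (by ring)
      (uw 3 (by omega) (by omega)) (uw 4 (by omega) (by omega)) (by omega) hb).2.symm
  · exact (exchange_of (nw 5 (by omega) (by omega)) (j := τ + 4) (by ring)
      (uw 4 (by omega) (by omega)) (uw 5 (by omega) (by omega)) (by omega) ua).2.symm
  · exact (exchange_of (nw 6 (by omega) (by omega)) (j := τ + 5) (by ring)
      (uw 5 (by omega) (by omega)) (uw 6 (by omega) (by omega)) (by omega) ux).2.symm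

/-- With ten points, the three crossings of `exists_core` are followed by the first of them, and
the sweep continues within the core. -/
theorem inverts_closed {τ : ℤ} {a b x z : Fin (2 * n)} (h0 : S.D τ = 2) (h3 : S.D (τ + 3) = 1)
    (hn : n = 5) (ha : S.Crosses τ a) (ha1 : S.u τ a = 1) (hb : S.Crosses τ b)
    (hb9 : S.u (τ + 3) b = 9) (hx : S.Crosses (τ + 3) x) (hx1 : S.u (τ + 3) x = -1)
    (hzc : S.Crosses (τ + 6) z) (hz : S.u (τ + 6) z = -3) :
    S.Inverts (τ + 6) (S.bar x) a ∧ S.Inverts (τ + 7) a (S.bar z) ∧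
      S.Inverts (τ + 7) (S.bar x) b := by
  have ha' : S.Crosses (τ + 2 * n) (S.bar a) := crosses_bar.2 (crosses_add_iff.2 ha)
  have ha1' : S.u (τ + 2 * n) (S.bar a) = 1 := by
    rw [u_bar, S.anti, ha1]
    rfl
  have hD : S.D (τ + 2 * n) = 2 := (S.radius_add τ).trans h0
  have ua : ∀ k, 5 ≤ k → k ≤ 8 → S.u (τ + k) a = 17 - 2 * k := fun k h₁ h₂ => by
    have := ha'.path_before ha1' (j := τ + k) (by omega) (by omega)
    rw [u_bar] at this
    omega
  have ux : ∀ k, 3 ≤ k → k ≤ 7 → S.u (τ + k) (S.bar x) = 2 * k - 5 := fun k h₁ h₂ => by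
    have := (crosses_bar.2 hx).path_after (by rw [u_bar, hx1]; rfl) (j := τ + k) (by omega)
      (by omega)
    omega
  have na : ¬ S.Crosses (τ + 7) a := ha.not_crosses_of_ne (by omega) (by omega) (by omega)
  have nx : ∀ k, 3 < k → k < 9 → ¬ S.Crosses (τ + k) (S.bar x) := fun k h₁ h₂ =>
    (crosses_bar.2 hx).not_crosses_of_ne (by omega) (by omega) (by omega)
  have nb : ∀ k, 0 < k → k < 10 → ¬ S.Crosses (τ + k) b := fun k h₁ h₂ =>
    hb.not_crosses_of_ne (by omega) (by omega) (by omega)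
  -- With ten points `9` is the outermost place. Three moves bring `b` no lower than `3`, and at
  -- time `τ + 6` the places `3`, `5`, `7` belong to the conjugate of `z`, to `a` and to the
  -- conjugate of `x`.
  have ub : S.u (τ + 6) b = 9 := by
    have s₄ := step_le (nb 4 (by omega) (by omega))
    have s₅ := step_le (nb 5 (by omega) (by omega))
    have s₆ := step_le (nb 6 (by omega) (by omega))
    rw [show τ + 4 - 1 = τ + 3 by ring] at s₄
    rw [show τ + 5 - 1 = τ + 4 by ring] at s₅
    rw [show τ + 6 - 1 = τ + 5 by ring] at s₆
    have e₃ : S.u (τ + 6) b ≠ 3 := fun h => by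
      have := S.inj (τ + 6) b (S.bar z) (by rw [h, u_bar, hz]; rfl)
      subst this
      exact nb 6 (by omega) (by omega) (crosses_bar.2 hzc)
    have e₅ : S.u (τ + 6) b ≠ 5 := fun h => by
      have := S.inj (τ + 6) b a (by rw [h, ua 6 (by omega) (by omega)]; rfl)
      subst this
      have := ha.path_after ha1 (j := τ + 3) (by omega) (by omega)
      omega
    have e₇ : S.u (τ + 6) b ≠ 7 := fun h => by
      have := S.inj (τ + 6) b (S.bar x) (by rw [h, ux 6 (by omega) (by omega)]; rfl)
      subst this
      have := ux 3 (by omega) (by omega)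
      omega
    have := S.odd (τ + 6) b
    have := S.upper (τ + 6) b
    omega
  refine ⟨?_, ?_, ?_⟩
  · exact (exchange_of (nx 6 (by omega) (by omega)) (j := τ + 5) (by ring)
      (ux 5 (by omega) (by omega)) (ux 6 (by omega) (by omega)) (by omega)
      (ua 5 (by omega) (by omega))).2
  · exact (exchange_of na (j := τ + 6) (by ring)
      (ua 6 (by omega) (by omega)) (ua 7 (by omega) (by omega)) (by omega)
      (by rw [u_bar, hz]; rfl)).2
  · exact (exchange_of (nx 7 (by omega) (by omega)) (j := τ + 6) (by ring)
      (ux 6 (by omega) (by omega)) (ux 7 (by omega) (by omega)) (by omega) ub).2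

end SymmetricSweep

theorem planeDet_sub_neg_left (v w : ℝ × ℝ) : planeDet (v - -v) w = 2 * planeDet v w := by
  simp only [planeDet, Prod.fst_sub, Prod.snd_sub, Prod.fst_neg, Prod.snd_neg]
  ring

theorem planeDet_sub_neg_right (v w : ℝ × ℝ) : planeDet v (w - -w) = 2 * planeDet v w := by
  simp only [planeDet, Prod.fst_sub, Prod.snd_sub, Prod.fst_neg, Prod.snd_neg]
  ring

theorem planeDet_neg_sub_left (v v' w : ℝ × ℝ) :
    planeDet (-v - v') w = -planeDet (v + v') w := by
  simp only [planeDet, Prod.fst_sub, Prod.snd_sub, Prod.fst_neg, Prod.snd_neg, Prod.fst_add,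
    Prod.snd_add]
  ring

theorem planeDet_neg_sub_right (v w w' : ℝ × ℝ) :
    planeDet v (-w - w') = -planeDet v (w + w') := by
  simp only [planeDet, Prod.fst_sub, Prod.snd_sub, Prod.fst_neg, Prod.snd_neg, Prod.fst_add,
    Prod.snd_add]
  ring

/-! ### The contradiction and the central signature -/

namespace AllowableSequence

variable {n : ℕ} {A : AllowableSequence (2 * n)} {hh : A.halfLength = 2 * n}
  {hs : A.IsCentrallySymmetric} {hg : A.InNoncentralGeneralPosition}

theorem not_isGeometricallyRealizable_of_radius {τ : ℤ} (h0 : (A.toSweep hh hs hg).D τ = 2)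
    (h3 : (A.toSweep hh hs hg).D (τ + 3) = 1) (h6 : (A.toSweep hh hs hg).D (τ + 6) = 2)
    (hn : 3 < n) : ¬ A.IsGeometricallyRealizable := by
  rintro ⟨P, hP, α, hα, hrange, hord⟩
  set S := A.toSweep hh hs hg
  have hper : S.D (τ + 2 * n) = 2 := (S.radius_add τ).trans h0
  obtain ⟨T, hT0, hT, hnext⟩ := S.exists_next (i := τ + 6) (by omega)
  obtain ⟨d, hd⟩ : ∃ d, S.D T = d := ⟨_, rfl⟩
  rw [hd] at hT hT0
  obtain rfl : T = τ + 8 + d := by omega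
  have hle : τ + 8 + d ≤ τ + 2 * n := by
    by_contra! h
    have := hnext (τ + 2 * n) (by omega) h
    omega
  -- The next crossing is either `τ + 2 * n`, the first one again, or it leaves room for its own
  -- interval before that of `τ + 2 * n`.
  have hcase : (d = 2 ∧ n = 5) ∨ 5 + d ≤ n := by
    rcases hle.eq_or_lt with h | h
    · rw [h, hper] at hd
      omega
    · have := SymmetricSweep.radius_add_le (S := S) (by omega) (by omega) h (by omega)
      omega
  obtain ⟨a, b, x, y, z, ⟨ha, ha1, hb, hb9⟩, ⟨hx, hx1⟩, ⟨hy, hz, hz3⟩, ⟨iax, iby⟩,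
    ⟨iay, ibz⟩, iaz, ixz⟩ := SymmetricSweep.exists_core h0 h3 h6 (by omega)
  let C : ℝ × ℝ := (1 / 2 : ℝ) • (P a + P (S.bar a))
  let X : Fin (2 * n) → ℝ × ℝ := fun p => P p - C
  have bar_of : ∀ p, P a + P (S.bar a) = P p + P (S.bar p) → X (S.bar p) = -X p := by
    intro p hp
    simp only [X, C, hp]
    module
  have add_eq : ∀ {i j : ℤ} {p q}, i < j → j < i + 2 * n → S.Crosses i p → S.Crosses j q →
      P p + P (S.bar p) = P q + P (S.bar q) := fun hij hji hp hq =>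
    add_bar_eq hP hα hrange hord hij hji hp hq
  have ba := bar_of a rfl
  have bx := bar_of x (add_eq (by omega) (by omega) ha hx)
  -- Since `a` and `b` cross in the same move, their midpoints are compared through `x`.
  have bb := bar_of b ((add_eq (by omega) (by omega) ha hx).trans
    (add_eq (by omega) (by omega) hb hx).symm)
  have byy := bar_of y (add_eq (by omega) (by omega) ha hy)
  have bz := bar_of z (add_eq (by omega) (by omega) ha hz)
  have hdet : ∀ {i : ℤ} {p q r s : Fin (2 * n)}, S.Inverts i p q → S.Inverts i r s →
      planeDet (X p - X q) (X r - X s) = 0 := by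
    intro i p q r s h h'
    have := planeDet_eq_zero hα hord h h'
    simp only [X, sub_sub_sub_cancel_right]
    exact this
  have hay : planeDet (X a) (X y) ≠ 0 := by
    have := planeDet_ne_zero hP hα hrange hord (by omega) (by omega) ha.inverts_bar
      hy.inverts_bar
    rw [← sub_sub_sub_cancel_right (P a) _ C, ← sub_sub_sub_cancel_right (P y) _ C] at this
    change planeDet (X a - X (S.bar a)) (X y - X (S.bar y)) ≠ 0 at this
    rw [ba, byy, planeDet_sub_neg_left, planeDet_sub_neg_right] at this
    intro h
    simp [h] at this
  have hab := hdet ha.inverts_bar hb.inverts_bar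
  rw [ba, bb, planeDet_sub_neg_left, planeDet_sub_neg_right] at hab
  have hyz := hdet hy.inverts_bar hz.inverts_bar
  rw [byy, bz, planeDet_sub_neg_left, planeDet_sub_neg_right] at hyz
  have h₂ := hdet iax iby
  have h₃ := hdet hx.inverts_bar iay
  rw [bx, planeDet_sub_neg_left] at h₃
  have h₃' := hdet hx.inverts_bar ibz
  rw [bx, planeDet_sub_neg_left] at h₃'
  rcases hcase with ⟨rfl, hn5⟩ | hn'
  · obtain ⟨ixa, iaz', ixb⟩ :=
      SymmetricSweep.inverts_closed h0 h3 hn5 ha ha1 hb hb9 hx hx1 hz hz3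
    have h₆ := hdet hy.inverts_bar ixa
    rw [byy, bx, planeDet_sub_neg_left, planeDet_neg_sub_right] at h₆
    have h₇ := hdet iaz' ixb
    rw [bz, bx, planeDet_neg_sub_right, sub_neg_eq_add] at h₇
    exact core_false_of_closed (z := X z) hay (by linarith) (by linarith) h₂ (by linarith) (by linarith)
      (by linarith) (by linarith)
  · obtain ⟨w, hw, ibw, iaw, ixw⟩ :=
      SymmetricSweep.exists_outer h0 h3 hd hT0 hn' ha ha1 hb9 hx hx1
    have h₄ := hdet iaz ibw
    have h₅ := hdet ixz iaw
    rw [bx, planeDet_neg_sub_left] at h₅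
    have h₆ := hdet hy.inverts_bar ixw
    rw [byy, bx, planeDet_sub_neg_left, planeDet_neg_sub_right] at h₆
    exact core_false_of_outer (z := X z) (w := X w) hay (by linarith) (by linarith) h₂ (by linarith) (by linarith)
      h₄ (by linarith) (by linarith)

theorem val_finRotate {t : ℕ} (k : Fin t) :
    (finRotate t k : ℕ) = if (k : ℕ) + 1 = t then 0 else (k : ℕ) + 1 := by
  obtain ⟨s, rfl⟩ : ∃ s, t = s + 1 := ⟨t - 1, by have := k.2; omega⟩
  split_ifs with h
  · obtain rfl : k = Fin.last s := Fin.ext (by simpa using h)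
    simp
  · exact coe_finRotate_of_ne_last (by
      rintro rfl
      simp at h)

/-- The time from a crossing to the next one is the sum of their radii. -/
theorem signature_next (S : SymmetricSweep n) {t : ℕ} {m : Fin t → ℤ} (hm : StrictMono m)
    (hmem : ∀ j : ℤ, (1 ≤ j ∧ j ≤ 2 * n ∧ 0 < S.D j) ↔ j ∈ Set.range m) (k : Fin t) :
    ∃ e : ℤ, m k + S.D (m k) + S.D (m (finRotate t k)) = m (finRotate t k) + 2 * n * e := by
  have hr : ∀ l, 1 ≤ m l ∧ m l ≤ 2 * n ∧ 0 < S.D (m l) := fun l => (hmem _).2 ⟨l, rfl⟩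
  obtain ⟨T, hT0, hT, hnext⟩ := S.exists_next (hr k).2.2
  have hk := hr k
  have hrot := val_finRotate k
  by_cases hlast : (k : ℕ) + 1 = t
  · rw [if_pos hlast] at hrot
    have h0 := hr (finRotate t k)
    have hper := S.radius_add (m (finRotate t k))
    have hle : T ≤ m (finRotate t k) + 2 * n := by
      by_contra! h
      have := hnext _ (by omega) h
      omega
    -- No index follows the last one, so the next crossing lies in the following halfperiod; this is
    -- the wraparound with `e = 1`.
    have hgt : 2 * n < T := by
      by_contra! h
      obtain ⟨l, hl⟩ := (hmem T).1 ⟨by omega, h, hT0⟩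
      have : k < l := hm.lt_iff_lt.1 (by omega)
      rw [Fin.lt_def] at this
      omega
    have hper' := S.radius_add (T - 2 * n)
    rw [sub_add_cancel] at hper'
    obtain ⟨l, hl⟩ := (hmem (T - 2 * n)).1 ⟨by omega, by omega, by omega⟩
    have : m (finRotate t k) ≤ m l := hm.monotone (by rw [Fin.le_def]; omega)
    obtain rfl : T = m (finRotate t k) + 2 * n := by omega
    exact ⟨1, by omega⟩
  · rw [if_neg hlast] at hrot
    have h1 := hr (finRotate t k)
    have hlt : m k < m (finRotate t k) := hm (by rw [Fin.lt_def]; omega)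
    have hle : T ≤ m (finRotate t k) := by
      by_contra! h
      have := hnext _ hlt h
      omega
    obtain ⟨l, hl⟩ := (hmem T).1 ⟨by omega, by omega, hT0⟩
    have hkl : k < l := hm.lt_iff_lt.1 (by omega)
    rw [Fin.lt_def] at hkl
    have : m (finRotate t k) ≤ m l := hm.monotone (by rw [Fin.le_def]; omega)
    obtain rfl : T = m (finRotate t k) := by omega
    exact ⟨0, by omega⟩

end AllowableSequence

open AllowableSequence in
theorem theorem4p9 (n t : ℕ) (ht : 3 ≤ t) (d : Fin t → ℕ)
    (htriple : ∃ i : Fin t, d i = 2 ∧ d (finRotate t i) = 1 ∧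
      d (finRotate t (finRotate t i)) = 2)
    (A : AllowableSequence (2 * n)) (hA : A.IsDC d) :
    ¬ A.IsGeometricallyRealizable := by
  obtain ⟨i, hd0, hd1, hd2⟩ := htriple
  obtain ⟨m, hm, hmem, hcard⟩ := hA.centralSignature
  have hh := hA.evenNearCritical.2
  set S := A.toSweep hh hA.centrallySymmetric hA.noncentralGeneralPosition with hS
  have hmem' : ∀ j : ℤ, (1 ≤ j ∧ j ≤ 2 * n ∧ 0 < S.D j) ↔ j ∈ Set.range m := by
    intro j
    rw [← hmem j, ← crossingRadius_pos_iff, hh, Set.mem_Icc, and_assoc]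
    push_cast
    rfl
  have hD : ∀ k, S.D (m k) = d k := by
    intro k
    obtain ⟨s, hs, hc, hsc⟩ := hcard k
    have h := two_mul_crossingRadius hs hc
    rw [hsc] at h
    change 2 * S.D (m k) = _ at h
    push_cast at h
    omega
  obtain ⟨e, he⟩ := signature_next S hm hmem' i
  obtain ⟨f, hf⟩ := signature_next S hm hmem' (finRotate t i)
  have h0 := hD i
  have h1 := hD (finRotate t i)
  have h2 := hD (finRotate t (finRotate t i))
  rw [hd0] at h0
  rw [hd1] at h1
  rw [hd2] at h2
  rw [h0, h1] at he
  rw [h1, h2] at hf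
  push_cast at h0 h1 h2 he hf
  have e3 : m i + 3 = m (finRotate t i) + 2 * n * e := by omega
  have e6 : m i + 6 = m (finRotate t (finRotate t i)) + 2 * n * (e + f) := by
    rw [mul_add]
    omega
  have h3 : S.D (m i + 3) = 1 := by rw [e3, S.radius_add_mul, h1]
  have h6 : S.D (m i + 6) = 2 := by rw [e6, S.radius_add_mul, h2]
  refine not_isGeometricallyRealizable_of_radius h0 h3 h6 ?_
  by_contra! hn
  have hle := S.D_le (m i)
  have hper := S.radius_add (m i)
  -- For `n = 2` the crossings at `m i + 3` and `m i + 4` are too close. For `n = 3` the two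
  -- crossings of radius 2 are a halfperiod apart, so their indices agree, and two rotations fix no
  -- index when `t ≥ 3`.
  obtain rfl | rfl : n = 2 ∨ n = 3 := by omega
  · have := SymmetricSweep.radius_add_le (S := S) (i := m i + 3) (j := m i + 2 * (2 : ℕ))
      (by omega) (by omega) (by omega) (by omega)
    omega
  · have h₁ := (hmem' (m i)).2 ⟨i, rfl⟩
    have h₂ := (hmem' (m (finRotate t (finRotate t i)))).2 ⟨_, rfl⟩
    have h₃ : i = finRotate t (finRotate t i) := hm.injective (by push_cast at *; omega)
    have h₄ := val_finRotate i
    have h₅ := val_finRotate (finRotate t i)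
    rw [← h₃] at h₅
    split_ifs at h₄ h₅ <;> omega
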